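/- All logarithms are base 2. A partial Boolean function on $n$ bits is a function $f\colon \mathrm{Dom}(f)\to\{0,1\}$ with $\mathrm{Dom}(f)\subseteq\{0,1\}^n$. Its randomized query complexity $R(f)$ is the minimum height of a randomized decision tree (a probability distribution over deterministic decision trees querying single input bits; its height is the maximum height of a tree in its support) that outputs $f(x)$ with probability at least $2/3$ for every $x\in\mathrm{Dom}(f)$. For $f$ on $n$ bits and $g$ on $m$ bits, $f\circ g$ is the partial Boolean function on $nm$ bits given by $(f\circ g)(x^1,\dots,x^n)=f(g(x^1)\cdots g(x^n))$, with domain the set of inputs for which every $x^i\in\mathrm{Dom}(g)$ and $g(x^1)\cdots g(x^n)\in\mathrm{Dom}(f)$. For $m\ge 1$ let $\mathrm{GapMaj}_m$ be the partial Boolean function on $m$ bits that equals $1$ on inputs of Hamming weight $\lceil m/2+2\sqrt m\rceil$, equals $0$ on inputs of Hamming weight $\lfloor m/2-2\sqrt m\rfloor$, and is undefined elsewhere. For $k\ge 1$ let $\mathrm{ApproxIndex}_k$ be the partial function of $(a,x)\in\{0,1\}^k\times\{0,1,2\}^{2^k}$, with the entries of $x$ indexed by $b\in\{0,1\}^k$,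 whose value is $x_a$ if $x_a\in\{0,1\}$, $x_b=x_a$ for all $b$ at Hamming distance at most $\frac k2-2\sqrt{k\log k}$ from $a$, and $x_b=2$ for all other $b$; it is undefined elsewhere. It is regarded as a partial Boolean function on $k+2\cdot 2^k$ bits by writing each of the letters $0,1,2$ in binary with two bits (inputs containing the invalid code $11$ are outside the domain). Theorem. Let $f_k=\mathrm{ApproxIndex}_k$ and $g_k=\mathrm{GapMaj}_k$. Then $R(f_k)\to\infty$ and $R(g_k)\to\infty$ as $k\to\infty$, and \[R(f_k\circ g_k)=O\left(R(f_k)^{2/3}\,R(g_k)^{2/3}\,\log^{2/3}R(f_k)\right).\] Consequently the randomized composition conjecture fails for partial functions: there is no constant $c>0$ such that $R(f\circ g)\ge c\,R(f)\,R(g)$ for all partial Boolean functions $f$ and $g$. -/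

import Mathlib

open Filter Asymptotics

/-- A partial Boolean function on the bits indexed by the finite type `ι`;
the value `none` means that the input is outside the domain (the promise). -/
abbrev PartialBoolFn (ι : Type*) := (ι → Bool) → Option Bool

/-- Composition `f ∘ g`: one block of input bits of `g` for each input bit of `f`.
The domain consists of the inputs all of whose blocks are in the domain of `g` and whose
string of values of `g` is in the domain of `f`. -/
def PartialBoolFn.comp {ι κ : Type*} [Fintype ι] (f : PartialBoolFn ι) (g : PartialBoolFn κ) :
    PartialBoolFn (ι × κ) := fun x =>
  if h : ∀ i, (g fun j => x (i, j)).isSome then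
    f fun i => (g fun j => x (i, j)).get (h i)
  else none

/-- Deterministic decision trees over the variables `ι`. In `node i l r` the variable `i` is
queried, and the computation goes on in `l` if its value is `0` and in `r` if it is `1`. -/
inductive DecisionTree (ι : Type*) where
  | leaf (b : Bool) : DecisionTree ι
  | node (i : ι) (l r : DecisionTree ι) : DecisionTree ι

namespace DecisionTree

variable {ι : Type*}

/-- The output of the tree on the input `x`. -/
def eval : DecisionTree ι → (ι → Bool) → Bool
  | leaf b, _ => b
  | node i l r, x => if x i then r.eval x else l.eval x

/-- The height, i.e. the maximal number of queries on a root-to-leaf path. -/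
def height : DecisionTree ι → ℕ
  | leaf _ => 0
  | node _ l r => max l.height r.height + 1

/-- The variable `i` labels some internal node. -/
def Queries (i : ι) : DecisionTree ι → Prop
  | leaf _ => False
  | node j l r => j = i ∨ l.Queries i ∨ r.Queries i

/-- No internal node has the same label as one of its descendants. -/
def ReadOnce : DecisionTree ι → Prop
  | leaf _ => True
  | node i l r => ¬ l.Queries i ∧ ¬ r.Queries i ∧ l.ReadOnce ∧ r.ReadOnce

end DecisionTree

/-- A randomized decision tree: a probability distribution over decision trees. -/
structure RandDecisionTree (ι : Type*) where
  /-- the distribution -/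
  law : PMF (DecisionTree ι)
  readOnce : ∀ D ∈ law.support, D.ReadOnce

namespace RandDecisionTree

variable {ι : Type*}

/-- The height of the randomized tree, the maximal height of a tree in its support,
is at most `h`. -/
def HeightLE (T : RandDecisionTree ι) (h : ℕ) : Prop :=
  ∀ D ∈ T.law.support, D.height ≤ h

/-- The probability that the randomized tree outputs `b` on the input `x`. -/
noncomputable def prob (T : RandDecisionTree ι) (x : ι → Bool) (b : Bool) : ℝ :=
  (T.law.map (fun D => D.eval x) b).toReal

/-- The randomized tree computes `f` to error `ε`. -/
def Computes (T : RandDecisionTree ι) (f : PartialBoolFn ι) (ε : ℝ) : Prop :=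
  ∀ x b, f x = some b → 1 - ε ≤ T.prob x b

end RandDecisionTree

/-- Randomized query complexity `R_ε(f)`: the minimum height of a randomized decision tree
that computes `f` to error `ε`. -/
noncomputable def randQueryErr {ι : Type*} [Fintype ι] (ε : ℝ) (f : PartialBoolFn ι) : ℕ :=
  sInf {h : ℕ | ∃ T : RandDecisionTree ι, T.HeightLE h ∧ T.Computes f ε}

/-- Randomized query complexity `R(f) = R_{1/3}(f)`. -/
noncomputable def randQuery {ι : Type*} [Fintype ι] (f : PartialBoolFn ι) : ℕ :=
  randQueryErr (1 / 3) f

/-- The gap majority function on `m` bits. -/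
noncomputable def gapMaj (m : ℕ) : PartialBoolFn (Fin m) := fun x =>
  let w : ℤ := (Finset.univ.filter fun i => x i = true).card
  if w = ⌈(m : ℝ) / 2 + 2 * √(m : ℝ)⌉ then some true
  else if w = ⌊(m : ℝ) / 2 - 2 * √(m : ℝ)⌋ then some false
  else none

/-- The positions `a` and `b` have Hamming distance at most `k/2 - 2 √(k log k)`. -/
def CloseIndex {k : ℕ} (a b : Fin k → Bool) : Prop :=
  (hammingDist b a : ℝ) ≤ (k : ℝ) / 2 - 2 * √((k : ℝ) * Real.logb 2 k)

open Classical in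
/-- `ApproxIndex` over the array alphabet `{0, 1, 2}`. -/
noncomputable def approxIndexTernary (k : ℕ) (a : Fin k → Bool)
    (x : (Fin k → Bool) → Fin 3) : Option Bool :=
  if (x a = 0 ∨ x a = 1) ∧ (∀ b, CloseIndex a b → x b = x a) ∧
      (∀ b, ¬ CloseIndex a b → x b = 2) then
    some (decide (x a = 1))
  else none

/-- Two-bit binary representation (high bit first) of the letters `0, 1, 2`. -/
def decodeTrit : Bool → Bool → Option (Fin 3)
  | false, false => some 0
  | false, true => some 1
  | true, false => some 2
  | true, true => none

/-- `ApproxIndex` as a partial Boolean function on `k + 2 * 2 ^ k` bits: the `k` bits of the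
index, followed by the two bits of each of the `2 ^ k` letters of the array. -/
noncomputable def approxIndex (k : ℕ) : PartialBoolFn (Fin k ⊕ (Fin k → Bool) × Fin 2) :=
  fun y =>
    if h : ∀ b, (decodeTrit (y (.inr (b, 0))) (y (.inr (b, 1)))).isSome then
      approxIndexTernary k (fun i => y (.inl i))
        (fun b => (decodeTrit (y (.inr (b, 0))) (y (.inr (b, 1)))).get (h b))
    else none

/-- The randomized composition conjecture for partial functions:
`R(f ∘ g) = Ω(R(f) R(g))` for all partial Boolean functions `f` and `g`. -/
def RandomizedCompositionConjecture : Prop :=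
  ∃ c : ℝ, 0 < c ∧ ∀ (ι κ : Type) [Fintype ι] [Fintype κ]
    (f : PartialBoolFn ι) (g : PartialBoolFn κ),
    c * ((randQuery f : ℝ) * (randQuery g : ℝ)) ≤ (randQuery (f.comp g) : ℝ)

/-! The gap comes from the fact that the index of `approxIndex` need not be recovered exactly: every
guess that agrees with it in at least `k/2 + 2√(k log k)` coordinates points at an entry holding the
answer. One random bit of a `gapMaj` block has advantage about `2/√k`, and the majority of `q`
samples multiplies the advantage by order `√q`. Hence order `log k` samples per block, far fewer
than the order `k` needed for bounded error, give each index bit an advantage `3√(log k / k)`. By a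
Chernoff bound the resulting guess is close to the index with probability at least `2/3`, and one
block is then read in full. The cost is `O(k log k)` (`card_sampleMaj_ne_le`,
`card_many_failures_le`, `eventually_randQuery_comp_le`).

Separately, both functions are hard. For `gapMaj`, one query has chi-square divergence `O(1/k)`
between the two weights, and the factors multiply along the tree (`sq_accept_le`), so order `k`
queries are needed. For `approxIndex`, even when `√(k log k)` index bits are known, a fixed array
position is close to a random completion of the index only with probability `exp(-4 log k)`
(`card_close_le`); a tree of that height therefore almost always sees only letters `2`
(`card_hits_le`).

With `R = √(k log k)` the product of the complexities is at least of order `R * k`, while the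
composition costs `O(R ^ 2)`, and `R = o(k)`. -/

/-! ### Deterministic trees: pruning and batches of queries -/

namespace DecisionTree

variable {ι : Type*}

open Classical in
/-- Remove from a tree the queries to variables whose value is already known. -/
noncomputable def prune : (ι → Option Bool) → DecisionTree ι → DecisionTree ι
  | _, leaf b => leaf b
  | σ, node i l r =>
    match σ i with
    | some false => prune σ l
    | some true => prune σ r
    | none => node i (prune (Function.update σ i (some false)) l)
        (prune (Function.update σ i (some true)) r)

open Classical in
theorem not_queries_prune (D : DecisionTree ι) (σ : ι → Option Bool) (i : ι)
    (h : (σ i).isSome) : ¬ (D.prune σ).Queries i := by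
  induction D generalizing σ with
  | leaf b => simp [prune, Queries]
  | node j l r hl hr =>
    rw [prune]
    split
    · exact hl σ h
    · exact hr σ h
    · rename_i hj
      have hij : i ≠ j := by rintro rfl; simp [hj] at h
      simp only [Queries, not_or]
      refine ⟨hij.symm, hl _ ?_, hr _ ?_⟩ <;> simpa [Function.update_of_ne hij] using h

/-- Sampling with replacement can repeat a query, whereas a `RandDecisionTree` is supported on
read-once trees; pruning reconciles the two without changing outputs or increasing height. -/
theorem readOnce_prune (D : DecisionTree ι) (σ : ι → Option Bool) : (D.prune σ).ReadOnce := by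
  induction D generalizing σ with
  | leaf b => simp [prune, ReadOnce]
  | node j l r hl hr =>
    rw [prune]
    split
    · exact hl σ
    · exact hr σ
    · exact ⟨not_queries_prune _ _ _ (by simp), not_queries_prune _ _ _ (by simp), hl _, hr _⟩

open Classical in
theorem height_prune_le (D : DecisionTree ι) (σ : ι → Option Bool) :
    (D.prune σ).height ≤ D.height := by
  induction D generalizing σ with
  | leaf b => simp [prune]
  | node j l r hl hr =>
    rw [prune]
    split
    · have := hl σ; simp only [height]; omega
    · have := hr σ; simp only [height]; omega
    · simp only [height]
      have := hl (Function.update σ j (some false))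
      have := hr (Function.update σ j (some true))
      omega

open Classical in
theorem eval_prune (D : DecisionTree ι) (σ : ι → Option Bool) (x : ι → Bool)
    (h : ∀ i b, σ i = some b → x i = b) : (D.prune σ).eval x = D.eval x := by
  induction D generalizing σ with
  | leaf b => simp [prune]
  | node j l r hl hr =>
    have upd : ∀ c, x j = c → ∀ i b, Function.update σ j (some c) i = some b → x i = b := by
      intro c hc i b hi
      by_cases hij : i = j
      · subst hij; simp at hi; rw [hc, hi]
      · rw [Function.update_of_ne hij] at hi; exact h i b hi
    rw [prune]
    split
    · rename_i hj
      rw [hl σ h, eval, h _ _ hj]; simp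
    · rename_i hj
      rw [hr σ h, eval, h _ _ hj]; simp
    · simp only [eval]
      cases hx : x j
      · simpa using hl _ (upd _ hx)
      · simpa using hr _ (upd _ hx)

open Classical in
/-- Query the variables of a list, recording the answers in `σ`, and go on with the tree that
`F` assigns to the recorded answers. -/
noncomputable def queryAll (F : (ι → Bool) → DecisionTree ι) :
    List ι → (ι → Bool) → DecisionTree ι
  | [], σ => F σ
  | i :: s, σ => node i (queryAll F s (Function.update σ i false))
      (queryAll F s (Function.update σ i true))

open Classical in
theorem eval_queryAll (F : (ι → Bool) → DecisionTree ι) (s : List ι) (σ x : ι → Bool) :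
    (queryAll F s σ).eval x = (F fun i => if i ∈ s then x i else σ i).eval x := by
  induction s generalizing σ with
  | nil => simp [queryAll]
  | cons i s ih =>
    have key : ∀ c, x i = c → (fun j => if j ∈ s then x j else Function.update σ i c j) =
        fun j => if j ∈ i :: s then x j else σ j := by
      intro c hc
      funext j
      by_cases hj : j = i
      · subst hj; simp [hc]
      · simp [hj]
    cases hx : x i
    · simp only [queryAll, eval, hx, Bool.false_eq_true, if_false]
      rw [ih, key _ hx]
    · simp only [queryAll, eval, hx, if_true]
      rw [ih, key _ hx]

open Classical in
theorem height_queryAll_le (F : (ι → Bool) → DecisionTree ι) (s : List ι) (σ : ι → Bool) (h : ℕ)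
    (hF : ∀ τ, (F τ).height ≤ h) : (queryAll F s σ).height ≤ s.length + h := by
  induction s generalizing σ with
  | nil => simpa [queryAll] using hF σ
  | cons i s ih =>
    have h0 := ih (Function.update σ i false)
    have h1 := ih (Function.update σ i true)
    simp only [queryAll, height, List.length_cons]
    omega

end DecisionTree

/-! ### Randomized trees: finite families and averaging -/

namespace RandDecisionTree

variable {ι : Type*}

/-- The pruned trees of a finite family, with the uniform distribution on the family. -/
noncomputable def uniform {Ω : Type*} [Fintype Ω] [Nonempty Ω] (D : Ω → DecisionTree ι) :
    RandDecisionTree ι where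
  law := (PMF.uniformOfFintype Ω).map fun r => (D r).prune fun _ => none
  readOnce := by
    intro E hE
    rw [PMF.support_map] at hE
    obtain ⟨r, -, rfl⟩ := hE
    exact DecisionTree.readOnce_prune _ _

theorem uniform_heightLE {Ω : Type*} [Fintype Ω] [Nonempty Ω] (D : Ω → DecisionTree ι) (h : ℕ)
    (hD : ∀ r, (D r).height ≤ h) : (uniform D).HeightLE h := by
  intro E hE
  simp only [uniform] at hE
  rw [PMF.support_map] at hE
  obtain ⟨r, -, rfl⟩ := hE
  exact (DecisionTree.height_prune_le _ _).trans (hD r)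

theorem uniform_prob {Ω : Type*} [Fintype Ω] [Nonempty Ω] (D : Ω → DecisionTree ι)
    (x : ι → Bool) (b : Bool) : (uniform D).prob x b =
      (Finset.univ.filter fun r => (D r).eval x = b).card / Fintype.card Ω := by
  have h1 : (uniform D).law.map (fun E => E.eval x) =
      (PMF.uniformOfFintype Ω).map fun r => (D r).eval x := by
    rw [uniform, PMF.map_comp]
    congr 1
    funext r
    exact DecisionTree.eval_prune _ _ _ (by simp)
  rw [prob, h1, PMF.map_apply, tsum_fintype]
  simp only [PMF.uniformOfFintype_apply, eq_comm (a := b)]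
  rw [← Finset.sum_filter, Finset.sum_const, nsmul_eq_mul, ENNReal.toReal_mul,
    ENNReal.toReal_inv]
  simp [div_eq_mul_inv]

theorem hasSum_prob (T : RandDecisionTree ι) (x : ι → Bool) (b : Bool) :
    HasSum (fun D => (T.law D).toReal * if D.eval x = b then 1 else 0) (T.prob x b) := by
  have h : ∀ D, (T.law D).toReal * (if D.eval x = b then (1 : ℝ) else 0) =
      (if b = D.eval x then T.law D else 0).toReal := by
    intro D
    by_cases h : D.eval x = b
    · simp [h]
    · simp [h, Ne.symm h]
  simp_rw [h]
  have hne : ∀ D, (if b = D.eval x then T.law D else 0) ≠ ⊤ := by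
    intro D
    split_ifs
    · exact PMF.apply_ne_top _ _
    · simp
  have hsum : ∑' D, (if b = D.eval x then T.law D else 0) ≠ ⊤ := by
    have := PMF.apply_ne_top (T.law.map fun D => D.eval x) b
    rw [PMF.map_apply] at this
    convert this
  have := ENNReal.hasSum_toReal hsum
  rw [← ENNReal.tsum_toReal_eq hne] at this
  rw [prob, PMF.map_apply]
  convert this

theorem hasSum_law (T : RandDecisionTree ι) : HasSum (fun D => (T.law D).toReal) 1 := by
  have := ENNReal.hasSum_toReal (f := fun D => T.law D) (by simp [PMF.tsum_coe])
  simpa [PMF.tsum_coe, ← ENNReal.tsum_toReal_eq, PMF.apply_ne_top] using this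

/-- A linear bound on the success indicators that holds for every deterministic tree holds for the
success probabilities of a randomized tree. -/
theorem sum_prob_le {J : Type*} (T : RandDecisionTree ι) (s : Finset J) (c : J → ℝ)
    (x : J → ι → Bool) (b : J → Bool) (M : ℝ)
    (hM : ∀ D ∈ T.law.support, ∑ j ∈ s, c j * (if D.eval (x j) = b j then 1 else 0) ≤ M) :
    ∑ j ∈ s, c j * T.prob (x j) (b j) ≤ M := by
  have h1 : HasSum (fun D => ∑ j ∈ s, c j *
      ((T.law D).toReal * if D.eval (x j) = b j then 1 else 0))
      (∑ j ∈ s, c j * T.prob (x j) (b j)) :=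
    hasSum_sum fun j _ => (T.hasSum_prob (x j) (b j)).mul_left (c j)
  have h2 : HasSum (fun D => (T.law D).toReal * M) M := by
    simpa using T.hasSum_law.mul_right M
  refine hasSum_le (fun D => ?_) h1 h2
  by_cases hD : D ∈ T.law.support
  · calc _ = (T.law D).toReal * ∑ j ∈ s, c j * (if D.eval (x j) = b j then 1 else 0) := by
          rw [Finset.mul_sum]
          exact Finset.sum_congr rfl fun j _ => by ring
      _ ≤ _ := mul_le_mul_of_nonneg_left (hM D hD) ENNReal.toReal_nonneg
  · simp [(PMF.apply_eq_zero_iff _ _).2 hD]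

end RandDecisionTree

/-- A finite family of trees most of which are correct on each input bounds `R` from above. -/
theorem randQuery_le_of_family {ι Ω : Type*} [Fintype ι] [Fintype Ω] [Nonempty Ω]
    (f : PartialBoolFn ι) (D : Ω → DecisionTree ι) (h : ℕ) (hD : ∀ r, (D r).height ≤ h)
    (hf : ∀ x b, f x = some b →
      ((Finset.univ.filter fun r => (D r).eval x ≠ b).card : ℝ) ≤ Fintype.card Ω / 3) :
    randQuery f ≤ h := by
  refine Nat.sInf_le ⟨.uniform D, RandDecisionTree.uniform_heightLE D h hD, fun x b hx => ?_⟩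
  have hpos : (0 : ℝ) < Fintype.card Ω := by exact_mod_cast Fintype.card_pos
  have hsum : ((Finset.univ.filter fun r => (D r).eval x = b).card : ℝ) +
      (Finset.univ.filter fun r => (D r).eval x ≠ b).card = Fintype.card Ω := by
    exact_mod_cast Finset.card_filter_add_card_filter_not (s := Finset.univ) _
  rw [RandDecisionTree.uniform_prob, le_div_iff₀ hpos]
  linarith [hf x b hx]

/-- The minimum in the definition of `R` is attained. -/
theorem exists_randQuery {ι : Type*} [Fintype ι] (f : PartialBoolFn ι) :
    ∃ T : RandDecisionTree ι, T.HeightLE (randQuery f) ∧ T.Computes f (1 / 3) := by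
  classical
  -- Querying every variable makes the set of achievable heights nonempty, so its infimum is
  -- attained. The default `false` is used only outside the domain.
  let D : DecisionTree ι := DecisionTree.queryAll
    (fun y => .leaf ((f y).getD false)) Finset.univ.toList fun _ => false
  have hD : ∀ x, D.eval x = (f x).getD false := by
    intro x
    simp [D, DecisionTree.eval_queryAll, DecisionTree.eval]
  refine Nat.sInf_mem (s := {h : ℕ | ∃ T : RandDecisionTree ι, T.HeightLE h ∧
    T.Computes f (1 / 3)}) ⟨D.height, .uniform fun _ : Unit => D,
      RandDecisionTree.uniform_heightLE _ _ fun _ => le_rfl, fun x b hx => ?_⟩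
  rw [RandDecisionTree.uniform_prob]
  simp [hD, hx]

/-! ### Linear lower bound for gap majority -/

namespace DecisionTree

variable {ι : Type*} [DecidableEq ι]

/-- The fraction of the subsets of `S` of cardinality `w` whose indicator is accepted. -/
noncomputable def accept (D : DecisionTree ι) (S : Finset ι) (w : ℕ) : ℝ :=
  (∑ T ∈ S.powersetCard w, if D.eval (fun i => decide (i ∈ T)) = true then 1 else 0) /
    (S.card.choose w : ℝ)

theorem eval_indicator_insert (D : DecisionTree ι) (i : ι) (h : ¬ D.Queries i) (T : Finset ι) :
    D.eval (fun j => decide (j ∈ insert i T)) = D.eval (fun j => decide (j ∈ T)) := by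
  induction D with
  | leaf b => rfl
  | node j l r hl hr =>
    simp only [Queries, not_or] at h
    have hj : decide (j ∈ insert i T) = decide (j ∈ T) := by simp [h.1]
    rw [eval, eval, hj, hl h.2.1, hr h.2.2]

/-- A uniform `(w + 1)`-subset of `insert i S` contains `i` with probability `(w + 1) / (|S| + 1)`.
Conditioned on either answer, its trace on `S` is again uniform, so acceptance obeys a recursion
along the tree. Since `r` never asks for `i` again, it cannot tell the subset from its trace. -/
theorem accept_node {i : ι} {l r : DecisionTree ι} (hr : ¬ r.Queries i) {S : Finset ι}
    (hi : i ∉ S) {w : ℕ} (hw : w + 1 ≤ S.card) :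
    (node i l r).accept (insert i S) (w + 1) =
      ((w + 1 : ℝ) / (S.card + 1)) * r.accept S w +
        (1 - (w + 1 : ℝ) / (S.card + 1)) * l.accept S (w + 1) := by
  have hdisj : Disjoint (S.powersetCard (w + 1)) ((S.powersetCard w).image (insert i)) := by
    rw [Finset.disjoint_left]
    intro T hT hT'
    obtain ⟨U, -, rfl⟩ := Finset.mem_image.1 hT'
    exact hi ((Finset.mem_powersetCard.1 hT).1 (Finset.mem_insert_self _ _))
  have hinj : Set.InjOn (insert i) (S.powersetCard w : Set (Finset ι)) := by
    intro U hU V hV h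
    have hU' : i ∉ U := fun h => hi ((Finset.mem_powersetCard.1 hU).1 h)
    have hV' : i ∉ V := fun h => hi ((Finset.mem_powersetCard.1 hV).1 h)
    rw [← Finset.erase_insert hU', h, Finset.erase_insert hV']
  have h0 : ∀ T ∈ S.powersetCard (w + 1),
      (if (node i l r).eval (fun j => decide (j ∈ T)) = true then (1 : ℝ) else 0) =
        if l.eval (fun j => decide (j ∈ T)) = true then 1 else 0 := by
    intro T hT
    have hiT : i ∉ T := fun h => hi ((Finset.mem_powersetCard.1 hT).1 h)
    simp [eval, hiT]
  have h1 : ∀ T ∈ S.powersetCard w,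
      (if (node i l r).eval (fun j => decide (j ∈ insert i T)) = true then (1 : ℝ) else 0) =
        if r.eval (fun j => decide (j ∈ T)) = true then 1 else 0 := by
    intro T hT
    rw [← eval_indicator_insert r i hr T]
    simp [eval]
  have c1 : ((S.card.choose w : ℕ) : ℝ) ≠ 0 := by
    exact_mod_cast (Nat.choose_pos (by omega)).ne'
  have c2 : ((S.card.choose (w + 1) : ℕ) : ℝ) ≠ 0 := by
    exact_mod_cast (Nat.choose_pos (by omega)).ne'
  have c3 : (((S.card + 1).choose (w + 1) : ℕ) : ℝ) ≠ 0 := by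
    exact_mod_cast (Nat.choose_pos (by omega)).ne'
  have e1 : ((S.card : ℝ) + 1) * S.card.choose w = (S.card + 1).choose (w + 1) * (w + 1) := by
    exact_mod_cast Nat.add_one_mul_choose_eq S.card w
  have e2 : (((S.card + 1).choose (w + 1) : ℕ) : ℝ) =
      S.card.choose w + S.card.choose (w + 1) := by
    exact_mod_cast Nat.choose_succ_succ' _ _
  have hS : (S.card : ℝ) + 1 ≠ 0 := by positivity
  have q1 : (w + 1 : ℝ) / (S.card + 1) = S.card.choose w / (S.card + 1).choose (w + 1) := by
    rw [div_eq_div_iff hS c3]; linarith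
  have q2 : 1 - (w + 1 : ℝ) / (S.card + 1) =
      S.card.choose (w + 1) / (S.card + 1).choose (w + 1) := by
    rw [q1, eq_div_iff c3, sub_mul, div_mul_cancel₀ _ c3]; linarith
  rw [accept, Finset.powersetCard_succ_insert hi, Finset.sum_union hdisj,
    Finset.sum_image hinj, Finset.sum_congr rfl h0, Finset.sum_congr rfl h1,
    Finset.card_insert_of_notMem hi, q2, q1, accept, accept]
  field_simp
  ring

/-- Cauchy-Schwarz for a change of measure between two Bernoulli distributions. -/
theorem sq_bernoulli_mean_le {p q χ a b : ℝ} (hq : 0 ≤ q * (1 - q)) (hχ : 0 ≤ χ)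
    (h : (p - q) ^ 2 ≤ χ * (q * (1 - q))) :
    (p * a + (1 - p) * b) ^ 2 ≤ (1 + χ) * (q * a ^ 2 + (1 - q) * b ^ 2) := by
  set m := q * a + (1 - q) * b with hm
  set V := q * (1 - q) * (a - b) ^ 2 with hV
  set e := (p - q) * (a - b) with he
  have h1 : q * a ^ 2 + (1 - q) * b ^ 2 = m ^ 2 + V := by rw [hm, hV]; ring
  have h2 : p * a + (1 - p) * b = m + e := by rw [hm, he]; ring
  have hV0 : 0 ≤ V := mul_nonneg hq (sq_nonneg _)
  have h3 : e ^ 2 ≤ χ * V := by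
    calc e ^ 2 = (p - q) ^ 2 * (a - b) ^ 2 := by rw [he]; ring
      _ ≤ χ * (q * (1 - q)) * (a - b) ^ 2 := mul_le_mul_of_nonneg_right h (sq_nonneg _)
      _ = χ * V := by rw [hV]; ring
  -- AM-GM with `e ^ 2 ≤ χ * V`, compared through squares so that `χ = 0` needs no separate case.
  have h4 : 2 * m * e ≤ χ * m ^ 2 + V := by
    refine le_of_sq_le_sq ?_ (by positivity)
    nlinarith [mul_le_mul_of_nonneg_left h3 (sq_nonneg m), sq_nonneg (χ * m ^ 2 - V)]
  rw [h1, h2]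
  nlinarith

/-- A read-once tree of small height hardly distinguishes the weights `v + Δ` and `v`. -/
theorem sq_accept_le (Δ : ℕ) {M : ℝ} (hM : 0 < M) (D : DecisionTree ι) (hD : D.ReadOnce)
    (S : Finset ι) (hS : ∀ i, D.Queries i → i ∈ S) (v : ℕ) (hv : M + D.height ≤ v)
    (hv' : M + D.height ≤ (S.card : ℝ) - v) (hw : v + Δ + D.height ≤ S.card) :
    D.accept S (v + Δ) ^ 2 ≤ (1 + (Δ / M) ^ 2) ^ D.height * D.accept S v := by
  induction D generalizing S v with
  | leaf b =>
    have c : ∀ w, w ≤ S.card → (leaf b : DecisionTree ι).accept S w = if b then 1 else 0 := by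
      intro w hw
      have : ((S.card.choose w : ℕ) : ℝ) ≠ 0 := by
        exact_mod_cast (Nat.choose_pos hw).ne'
      cases b <;> simp [accept, eval, this]
    simp only [height] at hw
    rw [c _ (by omega), c _ (by omega)]
    cases b <;> simp [height]
  | node i l r hl hr =>
    obtain ⟨qil, qir, rl, rr⟩ := hD
    obtain ⟨S, hi, rfl⟩ : ∃ S', i ∉ S' ∧ insert i S' = S :=
      ⟨S.erase i, by simp, Finset.insert_erase (hS i (Or.inl rfl))⟩
    have card : ((insert i S).card : ℝ) = S.card + 1 := by
      rw [Finset.card_insert_of_notMem hi]; simp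
    rw [card] at hv'
    rw [Finset.card_insert_of_notMem hi] at hw
    simp only [height, Nat.cast_add, Nat.cast_one] at hv hv' hw ⊢
    set h := max l.height r.height with hh
    have hlh : (l.height : ℝ) ≤ h := by exact_mod_cast le_max_left _ _
    have hrh : (r.height : ℝ) ≤ h := by exact_mod_cast le_max_right _ _
    have hlh' : l.height ≤ h := le_max_left _ _
    have hrh' : r.height ≤ h := le_max_right _ _
    obtain ⟨v, rfl⟩ : ∃ v', v = v' + 1 := by
      refine ⟨v - 1, (Nat.sub_add_cancel ?_).symm⟩
      have : (0 : ℝ) < v := by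
        have : (0 : ℝ) ≤ h := Nat.cast_nonneg _
        linarith
      exact Nat.succ_le_of_lt (by exact_mod_cast this)
    push_cast at hv hv'
    have hl' := hl rl S (fun j hj => (Finset.mem_insert.1 (hS j (Or.inr (Or.inl hj)))).resolve_left
      (by rintro rfl; exact qil hj)) (v + 1) (by push_cast; linarith) (by push_cast; linarith)
      (by omega)
    have hr' := hr rr S (fun j hj => (Finset.mem_insert.1 (hS j (Or.inr (Or.inr hj)))).resolve_left
      (by rintro rfl; exact qir hj)) v (by linarith) (by linarith) (by omega)
    have hκ : 1 ≤ 1 + (Δ / M) ^ 2 := by linarith [sq_nonneg (Δ / M)]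
    have acc0 : ∀ (E : DecisionTree ι) w, 0 ≤ E.accept S w := by
      intro E w
      exact div_nonneg (Finset.sum_nonneg fun _ _ => by split_ifs <;> norm_num)
        (Nat.cast_nonneg _)
    have hl2 : l.accept S (v + 1 + Δ) ^ 2 ≤ (1 + (Δ / M) ^ 2) ^ h * l.accept S (v + 1) :=
      hl'.trans (mul_le_mul_of_nonneg_right (pow_le_pow_right₀ hκ hlh') (acc0 _ _))
    have hr2 : r.accept S (v + Δ) ^ 2 ≤ (1 + (Δ / M) ^ 2) ^ h * r.accept S v :=
      hr'.trans (mul_le_mul_of_nonneg_right (pow_le_pow_right₀ hκ hrh') (acc0 _ _))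
    have hn : (0 : ℝ) < S.card + 1 := by positivity
    rw [show v + 1 + Δ = (v + Δ) + 1 by ring] at hl2 ⊢
    rw [accept_node qir hi (by omega), accept_node qir hi (by omega)]
    set q : ℝ := (v + 1) / (S.card + 1) with hq
    set p : ℝ := ((v + Δ : ℕ) + 1) / (S.card + 1) with hp
    have hh0 : (0 : ℝ) ≤ h := Nat.cast_nonneg _
    have q1 : M / (S.card + 1) ≤ q := by
      rw [hq]; gcongr; linarith
    have q2 : M / (S.card + 1) ≤ 1 - q := by
      rw [hq, le_sub_iff_add_le, ← add_div, div_le_one hn]; linarith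
    have hM' : 0 < M / (S.card + 1) := by positivity
    have q3 : (M / (S.card + 1)) ^ 2 ≤ q * (1 - q) := by
      rw [sq]; exact mul_le_mul q1 q2 hM'.le (hM'.le.trans q1)
    -- The two answer probabilities differ by `Δ / (|S| + 1)`. The slack `M` survives every query
    -- because the weight, the coweight and the height budget each decrease by at most one.
    have hpq : (p - q) ^ 2 ≤ (Δ / M) ^ 2 * (q * (1 - q)) := by
      calc (p - q) ^ 2 = (Δ / M) ^ 2 * (M / (S.card + 1)) ^ 2 := by
            rw [hp, hq]; push_cast; field_simp; ring
        _ ≤ _ := mul_le_mul_of_nonneg_left q3 (sq_nonneg _)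
    calc _ ≤ (1 + (Δ / M) ^ 2) * (q * r.accept S (v + Δ) ^ 2 +
          (1 - q) * l.accept S (v + Δ + 1) ^ 2) :=
          sq_bernoulli_mean_le ((sq_nonneg _).trans q3) (sq_nonneg _) hpq
      _ ≤ (1 + (Δ / M) ^ 2) * (q * ((1 + (Δ / M) ^ 2) ^ h * r.accept S v) +
          (1 - q) * ((1 + (Δ / M) ^ 2) ^ h * l.accept S (v + 1))) := by
          have := hM'.le.trans q1
          have := hM'.le.trans q2
          gcongr
      _ = _ := by ring

end DecisionTree

-- For one deterministic tree with acceptance rates `a` at weight `w` and `b` at weight `v`,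
-- `sq_accept_le` gives `a ^ 2 ≤ K * b`. This is not linear in the tree, so the square is replaced
-- by its tangent at `a = 2/3`: `4/3 * a - K * b ≤ 4/9`. The linear form passes to mixtures, and
-- success rates of `2/3` on both sides then force `K ≥ 4/3`.
open DecisionTree in
theorem randQuery_gapMaj_gt_of_bounds {m v w : ℕ} {M : ℝ} (hM : 0 < M) (hvw : v < w)
    (hv : ((v : ℤ)) = ⌊(m : ℝ) / 2 - 2 * √(m : ℝ)⌋)
    (hw : ((w : ℤ)) = ⌈(m : ℝ) / 2 + 2 * √(m : ℝ)⌉)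
    (h1 : M + randQuery (gapMaj m) ≤ v) (h2 : M + randQuery (gapMaj m) ≤ (m : ℝ) - v)
    (h3 : w + randQuery (gapMaj m) ≤ m) :
    4 / 3 ≤ (1 + (((w - v : ℕ) : ℝ) / M) ^ 2) ^ randQuery (gapMaj m) := by
  obtain ⟨T, hT, hf⟩ := exists_randQuery (gapMaj m)
  set h := randQuery (gapMaj m)
  set K := (1 + (((w - v : ℕ) : ℝ) / M) ^ 2) ^ h
  have hfw : ∀ U ∈ Finset.univ.powersetCard w,
      gapMaj m (fun i => decide (i ∈ U)) = some true := by
    intro U hU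
    have : (Finset.univ.filter fun i => decide (i ∈ U) = true).card = w := by
      simpa using (Finset.mem_powersetCard.1 hU).2
    simp only [gapMaj, this]
    rw [if_pos hw]
  have hfv : ∀ U ∈ Finset.univ.powersetCard v,
      gapMaj m (fun i => decide (i ∈ U)) = some false := by
    intro U hU
    have : (Finset.univ.filter fun i => decide (i ∈ U) = true).card = v := by
      simpa using (Finset.mem_powersetCard.1 hU).2
    simp only [gapMaj, this]
    rw [if_neg (by rw [← hw]; exact_mod_cast hvw.ne), if_pos hv]
  have cw : (0 : ℝ) < (m.choose w : ℕ) := by exact_mod_cast Nat.choose_pos (by omega)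
  have cv : (0 : ℝ) < (m.choose v : ℕ) := by exact_mod_cast Nat.choose_pos (by omega)
  have key := T.sum_prob_le ((Finset.univ.powersetCard w).disjSum (Finset.univ.powersetCard v))
    (Sum.elim (fun _ => 4 / 3 / (m.choose w : ℝ)) (fun _ => K / (m.choose v : ℝ)))
    (Sum.elim (fun U i => decide (i ∈ U)) (fun U i => decide (i ∈ U)))
    (Sum.elim (fun _ => true) (fun _ => false)) (4 / 9 + K) ?_
  · rw [Finset.sum_disjSum] at key
    simp only [Sum.elim_inl, Sum.elim_inr] at key
    have k1 : 4 / 3 * (2 / 3) ≤ ∑ U ∈ Finset.univ.powersetCard w,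
        4 / 3 / (m.choose w : ℝ) * T.prob (fun i => decide (i ∈ U)) true := by
      calc (4 / 3 * (2 / 3) : ℝ) = ∑ U ∈ (Finset.univ : Finset (Fin m)).powersetCard w,
            4 / 3 / (m.choose w : ℝ) * (2 / 3) := by
            rw [Finset.sum_const, Finset.card_powersetCard, Finset.card_univ, Fintype.card_fin,
              nsmul_eq_mul]
            field_simp
        _ ≤ _ := Finset.sum_le_sum fun U hU => mul_le_mul_of_nonneg_left
            (by have := hf _ _ (hfw U hU); linarith) (by positivity)
    have k2 : K * (2 / 3) ≤ ∑ U ∈ Finset.univ.powersetCard v,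
        K / (m.choose v : ℝ) * T.prob (fun i => decide (i ∈ U)) false := by
      calc K * (2 / 3) = ∑ U ∈ (Finset.univ : Finset (Fin m)).powersetCard v,
            K / (m.choose v : ℝ) * (2 / 3) := by
            rw [Finset.sum_const, Finset.card_powersetCard, Finset.card_univ, Fintype.card_fin,
              nsmul_eq_mul]
            field_simp
        _ ≤ _ := Finset.sum_le_sum fun U hU => mul_le_mul_of_nonneg_left
            (by have := hf _ _ (hfv U hU); linarith) (by positivity)
    linarith
  · intro D hD
    have hDh : (D.height : ℝ) ≤ h := by exact_mod_cast hT D hD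
    have hDh' : D.height ≤ h := hT D hD
    have hκ : 1 ≤ 1 + (((w - v : ℕ) : ℝ) / M) ^ 2 := by
      linarith [sq_nonneg (((w - v : ℕ) : ℝ) / M)]
    have main := sq_accept_le (w - v) hM D (T.readOnce D hD) Finset.univ (fun i _ => by simp) v
      (by linarith) (by simp only [Finset.card_univ, Fintype.card_fin]; linarith)
      (by simp only [Finset.card_univ, Fintype.card_fin]; omega)
    rw [show v + (w - v) = w by omega] at main
    have acc0 : 0 ≤ D.accept Finset.univ v :=
      div_nonneg (Finset.sum_nonneg fun _ _ => by split_ifs <;> norm_num) (Nat.cast_nonneg _)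
    have main2 : D.accept Finset.univ w ^ 2 ≤ K * D.accept Finset.univ v :=
      main.trans (mul_le_mul_of_nonneg_right (pow_le_pow_right₀ hκ hDh') acc0)
    rw [Finset.sum_disjSum]
    simp only [Sum.elim_inl, Sum.elim_inr]
    rw [← Finset.mul_sum, ← Finset.mul_sum]
    have e1 : 4 / 3 / (m.choose w : ℝ) * (∑ U ∈ Finset.univ.powersetCard w,
        if (D.eval fun i => decide (i ∈ U)) = true then (1 : ℝ) else 0) =
        4 / 3 * D.accept Finset.univ w := by
      simp only [accept, Finset.card_univ, Fintype.card_fin]; ring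
    have e2 : K / (m.choose v : ℝ) * (∑ U ∈ Finset.univ.powersetCard v,
        if (D.eval fun i => decide (i ∈ U)) = false then (1 : ℝ) else 0) =
        K * (1 - D.accept Finset.univ v) := by
      have : (∑ U ∈ (Finset.univ : Finset (Fin m)).powersetCard v,
          if (D.eval fun i => decide (i ∈ U)) = false then (1 : ℝ) else 0) = m.choose v -
          ∑ U ∈ Finset.univ.powersetCard v,
            if (D.eval fun i => decide (i ∈ U)) = true then (1 : ℝ) else 0 := by
        rw [eq_sub_iff_add_eq, ← Finset.sum_add_distrib, Finset.sum_congr rfl (g := fun _ => 1)]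
        · simp
        · intro U _
          cases D.eval fun i => decide (i ∈ U) <;> simp
      rw [this]
      simp only [accept, Finset.card_univ, Fintype.card_fin]
      field_simp
    refine (congrArg₂ (· + ·) e1 e2).le.trans ?_
    -- The tangent inequality `4/3 * a ≤ a ^ 2 + 4/9`.
    nlinarith [sq_nonneg (D.accept Finset.univ w - 2 / 3)]

theorem eventually_lt_randQuery_gapMaj :
    ∀ᶠ m : ℕ in atTop, (m : ℝ) / 2000 < randQuery (gapMaj m) := by
  filter_upwards [eventually_ge_atTop 10000] with m hm
  by_contra! hlt
  have hm' : (10000 : ℝ) ≤ m := by exact_mod_cast hm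
  set s := √(m : ℝ) with hs
  have hs2 : s ^ 2 = m := Real.sq_sqrt (by positivity)
  have hs100 : 100 ≤ s := Real.le_sqrt_of_sq_le (by linarith)
  have h0 : 0 ≤ ⌊(m : ℝ) / 2 - 2 * s⌋ := Int.floor_nonneg.2 (by nlinarith)
  have h0' : 0 ≤ ⌈(m : ℝ) / 2 + 2 * s⌉ := Int.ceil_nonneg (by nlinarith)
  obtain ⟨v, hv⟩ := Int.eq_ofNat_of_zero_le h0
  obtain ⟨w, hw⟩ := Int.eq_ofNat_of_zero_le h0'
  have v1 : (v : ℝ) ≤ m / 2 - 2 * s := by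
    have := Int.floor_le ((m : ℝ) / 2 - 2 * s); rw [hv] at this; simpa using this
  have v2 : (m : ℝ) / 2 - 2 * s < v + 1 := by
    have := Int.lt_floor_add_one ((m : ℝ) / 2 - 2 * s); rw [hv] at this; simpa using this
  have w1 : (m : ℝ) / 2 + 2 * s ≤ w := by
    have := Int.le_ceil ((m : ℝ) / 2 + 2 * s); rw [hw] at this; simpa using this
  have w2 : (w : ℝ) < m / 2 + 2 * s + 1 := by
    have := Int.ceil_lt_add_one ((m : ℝ) / 2 + 2 * s); rw [hw] at this; simpa using this
  have hvw : v < w := by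
    have : (v : ℝ) < w := by linarith
    exact_mod_cast this
  have hsm : 100 * s ≤ m := by nlinarith
  -- Both `v` and `m - v` are near `m / 2`, so `m / 4` leaves ample room. With a weight gap of at
  -- most `5√m`, a query costs a factor `1 + 400 / m`, and `m / 2000` queries cost at most `exp (1 /
  -- 5) ≤ 5 / 4 < 4 / 3`.
  have key := randQuery_gapMaj_gt_of_bounds (M := m / 4) (by positivity) hvw hv.symm hw.symm
    (by linarith) (by linarith) (by
      have : (w : ℝ) + randQuery (gapMaj m) ≤ m := by linarith
      exact_mod_cast this)
  have hΔ : ((w - v : ℕ) : ℝ) ≤ 5 * s := by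
    rw [Nat.cast_sub hvw.le]; linarith
  have hχ : (((w - v : ℕ) : ℝ) / (m / 4)) ^ 2 ≤ 400 / m := by
    calc (((w - v : ℕ) : ℝ) / (m / 4)) ^ 2 ≤ (5 * s / (m / 4)) ^ 2 := by gcongr
      _ = 400 * s ^ 2 / (m * m) := by ring
      _ = 400 / m := by rw [hs2]; field_simp
  have hpow : (1 + (((w - v : ℕ) : ℝ) / (m / 4)) ^ 2) ^ randQuery (gapMaj m) ≤
      Real.exp (1 / 5) := by
    calc _ ≤ (Real.exp (400 / m)) ^ randQuery (gapMaj m) := by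
          gcongr
          linarith [Real.add_one_le_exp (400 / (m : ℝ))]
      _ = Real.exp (randQuery (gapMaj m) * (400 / m)) := by rw [← Real.exp_nat_mul]
      _ ≤ Real.exp (1 / 5) := by
          apply Real.exp_le_exp.2
          rw [← mul_div_assoc, div_le_iff₀ (by positivity)]
          linarith
  have hexp : Real.exp (1 / 5) ≤ 5 / 4 := by
    have h := Real.add_one_le_exp (-(1 / 5 : ℝ))
    rw [Real.exp_neg] at h
    have hpos := Real.exp_pos (1 / 5)
    have := mul_le_mul_of_nonneg_right h hpos.le
    rw [inv_mul_cancel₀ hpos.ne'] at this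
    linarith
  linarith

/-! ### Lower bound for approximate indexing -/

open Classical in
/-- The input of `ApproxIndex` with index `a`, value `v` near `a` and `2` elsewhere. -/
noncomputable def indexInput {k : ℕ} (a : Fin k → Bool) (v : Bool) :
    Fin k ⊕ (Fin k → Bool) × Fin 2 → Bool
  | .inl i => a i
  | .inr (b, j) => if CloseIndex a b then (if j = 0 then false else v) else decide (j = 0)

/-- The input of `ApproxIndex` with index `a` and an array of letters `2`. -/
def blankInput {k : ℕ} (a : Fin k → Bool) : Fin k ⊕ (Fin k → Bool) × Fin 2 → Bool
  | .inl i => a i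
  | .inr (_, j) => decide (j = 0)

theorem approxIndex_indexInput {k : ℕ} (a : Fin k → Bool) (v : Bool) (h : CloseIndex a a) :
    approxIndex k (indexInput a v) = some v := by
  classical
  have hd : ∀ b, decodeTrit (indexInput a v (.inr (b, 0))) (indexInput a v (.inr (b, 1))) =
      some (if CloseIndex a b then (if v then 1 else 0) else 2) := by
    intro b
    by_cases hb : CloseIndex a b <;> cases v <;> simp [indexInput, hb, decodeTrit]
  have hs : ∀ b, (decodeTrit (indexInput a v (.inr (b, 0)))
      (indexInput a v (.inr (b, 1)))).isSome := fun b => by rw [hd]; rfl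
  have hg : ∀ b, (decodeTrit (indexInput a v (.inr (b, 0)))
      (indexInput a v (.inr (b, 1)))).get (hs b) =
        if CloseIndex a b then (if v then 1 else 0) else 2 := fun b => by simp [hd]
  rw [approxIndex, dif_pos hs]
  simp only [hg]
  have ha : (fun i => indexInput a v (.inl i)) = a := rfl
  rw [ha, approxIndexTernary, if_pos]
  · cases v <;> simp [h]
  · refine ⟨?_, fun b hb => ?_, fun b hb => ?_⟩
    · cases v <;> simp [h]
    · simp [h, hb]
    · simp [hb]

namespace DecisionTree

variable {k : ℕ}

/-- On the index `a` with a blank array, the tree queries an entry close to `a`. -/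
def Hits (a : Fin k → Bool) : DecisionTree (Fin k ⊕ (Fin k → Bool) × Fin 2) → Prop
  | leaf _ => False
  | node i l r => (∃ b j, i = .inr (b, j) ∧ CloseIndex a b) ∨
      if blankInput a i = true then r.Hits a else l.Hits a

theorem eval_indexInput (D : DecisionTree (Fin k ⊕ (Fin k → Bool) × Fin 2)) (a : Fin k → Bool)
    (v : Bool) (h : ¬ D.Hits a) : D.eval (indexInput a v) = D.eval (blankInput a) := by
  induction D with
  | leaf b => rfl
  | node i l r hl hr =>
    simp only [Hits, not_or] at h
    have hi : indexInput a v i = blankInput a i := by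
      rcases i with i | ⟨b, j⟩
      · rfl
      · have : ¬ CloseIndex a b := fun hb => h.1 ⟨b, j, rfl, hb⟩
        simp [indexInput, blankInput, this]
    rw [eval, eval, hi]
    split_ifs with hx
    · exact hr (by simpa [hx] using h.2)
    · exact hl (by simpa [hx] using h.2)

open Classical in
/-- The points of the subcube that agree with `σ` on `F`. -/
noncomputable def subcube (F : Finset (Fin k)) (σ : Fin k → Bool) : Finset (Fin k → Bool) :=
  Finset.univ.filter fun a => ∀ i ∈ F, a i = σ i

theorem mem_subcube {F : Finset (Fin k)} {σ a : Fin k → Bool} :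
    a ∈ subcube F σ ↔ ∀ i ∈ F, a i = σ i := by simp [subcube]

-- A fresh index query halves the subcube, and the two halves together contribute what the subcube
-- is allowed. An array query adds at most a `δ` fraction of the current subcube. Thus each level of
-- the tree costs at most `δ`, as long as no more than `t` index bits become known.
open Classical in
theorem card_hits_le {t : ℕ} {δ : ℝ} (hδ : 0 ≤ δ)
    (hc : ∀ (F : Finset (Fin k)) (σ b : Fin k → Bool), F.card ≤ t →
      (((subcube F σ).filter fun a => CloseIndex a b).card : ℝ) ≤ δ * (2 ^ k / 2 ^ F.card))
    (D : DecisionTree (Fin k ⊕ (Fin k → Bool) × Fin 2)) (F : Finset (Fin k)) (σ : Fin k → Bool)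
    (hF : F.card + D.height ≤ t) :
    (((subcube F σ).filter fun a => D.Hits a).card : ℝ) ≤
      D.height * (δ * (2 ^ k / 2 ^ F.card)) := by
  induction D generalizing F σ with
  | leaf b =>
    rw [Finset.filter_eq_empty_iff.2 fun a _ => by simp [Hits]]
    simp [height]
  | node i l r hl hr =>
    simp only [height] at hF ⊢
    set h := max l.height r.height
    have hlh : (l.height : ℝ) ≤ h := by exact_mod_cast le_max_left _ _
    have hrh : (r.height : ℝ) ≤ h := by exact_mod_cast le_max_right _ _
    have hlh' : l.height ≤ h := le_max_left _ _
    have hrh' : r.height ≤ h := le_max_right _ _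
    have hU : ∀ G : Finset (Fin k), 0 ≤ δ * (2 ^ k / 2 ^ G.card) := fun G => by positivity
    have hl' : ∀ (G : Finset (Fin k)) τ, G.card + h ≤ t →
        (((subcube G τ).filter fun a => l.Hits a).card : ℝ) ≤ h * (δ * (2 ^ k / 2 ^ G.card)) :=
      fun G τ hG => (hl G τ (by omega)).trans (mul_le_mul_of_nonneg_right hlh (hU G))
    have hr' : ∀ (G : Finset (Fin k)) τ, G.card + h ≤ t →
        (((subcube G τ).filter fun a => r.Hits a).card : ℝ) ≤ h * (δ * (2 ^ k / 2 ^ G.card)) :=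
      fun G τ hG => (hr G τ (by omega)).trans (mul_le_mul_of_nonneg_right hrh (hU G))
    have hU0 := hU F
    push_cast
    rcases i with i | ⟨b, j⟩
    -- The tree need not be read-once here: a bit already fixed may be asked again, and then only
    -- one branch is live.
    · by_cases hi : i ∈ F
      · have hsub : ∀ a ∈ subcube F σ, (node (.inl i) l r).Hits a ↔
            if σ i = true then r.Hits a else l.Hits a := by
          intro a ha
          rw [mem_subcube] at ha
          simp [Hits, blankInput, ha i hi]
        rw [Finset.filter_congr hsub]
        split_ifs
        · have := hr' F σ (by omega); linarith
        · have := hl' F σ (by omega); linarith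
      · have hcard : (insert i F).card = F.card + 1 := Finset.card_insert_of_notMem hi
        have hsub : (subcube F σ).filter (fun a => (node (.inl i) l r).Hits a) ⊆
            (subcube (insert i F) (Function.update σ i true)).filter (fun a => r.Hits a) ∪
            (subcube (insert i F) (Function.update σ i false)).filter (fun a => l.Hits a) := by
          intro a ha
          rw [Finset.mem_filter, mem_subcube] at ha
          have upd : a ∈ subcube (insert i F) (Function.update σ i (a i)) := by
            rw [mem_subcube]
            intro i' hi'
            by_cases h : i' = i
            · subst h; simp
            · rw [Function.update_of_ne h]
              exact ha.1 i' ((Finset.mem_insert.1 hi').resolve_left h)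
          have h2 := ha.2
          simp only [Hits, blankInput] at h2
          rw [Finset.mem_union, Finset.mem_filter, Finset.mem_filter]
          cases hai : a i
          · rw [hai] at upd; simp [hai] at h2; exact Or.inr ⟨upd, h2⟩
          · rw [hai] at upd; simp [hai] at h2; exact Or.inl ⟨upd, h2⟩
        have h1 := hr' (insert i F) (Function.update σ i true) (by omega)
        have h2 := hl' (insert i F) (Function.update σ i false) (by omega)
        have h3 : ((((subcube F σ).filter fun a => (node (.inl i) l r).Hits a).card : ℕ) : ℝ) ≤ _ :=
          Nat.cast_le.2 ((Finset.card_le_card hsub).trans (Finset.card_union_le _ _))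
        have h4 : δ * (2 ^ k / 2 ^ (insert i F).card) = δ * (2 ^ k / 2 ^ F.card) / 2 := by
          rw [hcard, pow_succ]; field_simp
        rw [h4] at h1 h2
        push_cast at h3
        linarith
    · have hsub : (subcube F σ).filter (fun a => (node (.inr (b, j)) l r).Hits a) ⊆
          (subcube F σ).filter (fun a => CloseIndex a b) ∪
          (subcube F σ).filter (fun a => if j = 0 then r.Hits a else l.Hits a) := by
        intro a ha
        rw [Finset.mem_filter] at ha
        have h2 := ha.2
        simp only [Hits, blankInput] at h2
        rw [Finset.mem_union, Finset.mem_filter, Finset.mem_filter]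
        rcases h2 with ⟨b', j', hb, h2⟩ | h2
        · obtain ⟨rfl, rfl⟩ : b = b' ∧ j = j' := by simpa using hb
          exact Or.inl ⟨ha.1, h2⟩
        · exact Or.inr ⟨ha.1, by simpa using h2⟩
      have h3 : ((((subcube F σ).filter
          fun a => (node (.inr (b, j)) l r).Hits a).card : ℕ) : ℝ) ≤ _ :=
        Nat.cast_le.2 ((Finset.card_le_card hsub).trans (Finset.card_union_le _ _))
      push_cast at h3
      have h1 := hc F σ b (by omega)
      have h2 : (((subcube F σ).filter fun a => if j = 0 then r.Hits a else l.Hits a).card : ℝ) ≤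
          h * (δ * (2 ^ k / 2 ^ F.card)) := by
        split_ifs
        · exact hr' F σ (by omega)
        · exact hl' F σ (by omega)
      linarith

open Classical in
/-- A Chernoff bound for the Hamming distance from a random point of a subcube. -/
theorem card_close_le (F : Finset (Fin k)) (σ b : Fin k → Bool) (lam d : ℝ) (hl : 0 ≤ lam) :
    (((subcube F σ).filter fun a => (hammingDist b a : ℝ) ≤ k / 2 - d).card : ℝ) ≤
      Real.exp (-lam * d + lam * F.card / 2 + k * lam ^ 2 / 8) * (2 ^ k / 2 ^ F.card) := by
  -- The product of these weights over the coordinates is `exp (-lam * distance)` on the subcube and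
  -- `0` off it, so its sum over the cube factorizes.
  set w : Fin k → Bool → ℝ := fun i c =>
    (if i ∈ F ∧ c ≠ σ i then 0 else 1) * (if b i ≠ c then Real.exp (-lam) else 1) with hw
  have hw0 : ∀ i c, 0 ≤ w i c := fun i c => by simp only [hw]; positivity
  have hFk : F.card ≤ k := by simpa using Finset.card_le_univ F
  have hprod : ∀ a ∈ (subcube F σ).filter fun a => (hammingDist b a : ℝ) ≤ k / 2 - d,
      Real.exp (-lam * (k / 2 - d)) ≤ ∏ i, w i (a i) := by
    intro a ha
    rw [Finset.mem_filter, mem_subcube] at ha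
    have : ∏ i, w i (a i) = ∏ i, if b i ≠ a i then Real.exp (-lam) else 1 := by
      refine Finset.prod_congr rfl fun i _ => ?_
      simp only [hw]
      rw [if_neg (fun h => h.2 (ha.1 i h.1)), one_mul]
    rw [this, Finset.prod_ite, Finset.prod_const_one, mul_one, Finset.prod_const,
      ← Real.exp_nat_mul]
    apply Real.exp_le_exp.2
    have h2 : (((Finset.univ.filter fun i => b i ≠ a i).card : ℕ) : ℝ) ≤ k / 2 - d := by
      have := ha.2
      unfold hammingDist at this
      convert this
    nlinarith
  have hsum : ∑ a : Fin k → Bool, ∏ i, w i (a i) = ∏ i, ∑ c, w i c := by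
    rw [Finset.prod_univ_sum, Fintype.piFinset_univ]
  have hfac : ∀ i, ∑ c, w i c ≤ if i ∈ F then 1 else 1 + Real.exp (-lam) := by
    intro i
    have he : Real.exp (-lam) ≤ 1 := Real.exp_le_one_iff.2 (by linarith)
    rw [Fintype.sum_bool]
    simp only [hw]
    by_cases hi : i ∈ F
    · cases σ i <;> cases b i <;> simp [hi, he]
    · cases b i <;> simp [hi, add_comm]
  -- Centring the two outcomes turns the free factor into a `cosh`.
  have hcosh : 1 + Real.exp (-lam) ≤ 2 * Real.exp (-lam / 2 + lam ^ 2 / 8) := by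
    have h1 := Real.cosh_le_exp_half_sq (lam / 2)
    have h2 : 1 + Real.exp (-lam) = 2 * (Real.exp (-lam / 2) * Real.cosh (lam / 2)) := by
      rw [Real.cosh_eq, mul_div_assoc', mul_add, ← Real.exp_add, ← Real.exp_add]
      ring_nf
      simp [add_comm]
    rw [h2, Real.exp_add]
    have h3 : (lam / 2) ^ 2 / 2 = lam ^ 2 / 8 := by ring
    rw [h3] at h1
    gcongr
  have hP : ∏ i, ∑ c, w i c ≤ (2 * Real.exp (-lam / 2 + lam ^ 2 / 8)) ^ (k - F.card) := by
    calc ∏ i, ∑ c, w i c ≤ ∏ i, if i ∈ F then 1 else 1 + Real.exp (-lam) :=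
          Finset.prod_le_prod (fun i _ => Finset.sum_nonneg fun c _ => hw0 i c) fun i _ => hfac i
      _ = (1 + Real.exp (-lam)) ^ (k - F.card) := by
          rw [Finset.prod_ite, Finset.prod_const_one, one_mul, Finset.prod_const]
          congr 1
          rw [Finset.filter_not, Finset.card_sdiff]
          simp
      _ ≤ _ := by gcongr
  have h1 : (((subcube F σ).filter fun a => (hammingDist b a : ℝ) ≤ k / 2 - d).card : ℝ) *
      Real.exp (-lam * (k / 2 - d)) ≤ (2 * Real.exp (-lam / 2 + lam ^ 2 / 8)) ^ (k - F.card) := by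
    calc _ = ∑ a ∈ (subcube F σ).filter fun a => (hammingDist b a : ℝ) ≤ k / 2 - d,
          Real.exp (-lam * (k / 2 - d)) := by rw [Finset.sum_const, nsmul_eq_mul]
      _ ≤ ∑ a ∈ (subcube F σ).filter fun a => (hammingDist b a : ℝ) ≤ k / 2 - d,
          ∏ i, w i (a i) := Finset.sum_le_sum hprod
      _ ≤ ∑ a : Fin k → Bool, ∏ i, w i (a i) :=
          Finset.sum_le_sum_of_subset_of_nonneg (Finset.subset_univ _)
            fun a _ _ => Finset.prod_nonneg fun i _ => hw0 _ _
      _ ≤ _ := hsum.le.trans hP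
  rw [← le_div_iff₀ (Real.exp_pos _)] at h1
  refine h1.trans ?_
  rw [mul_pow, ← Real.exp_nat_mul, pow_sub₀ _ two_ne_zero hFk, Nat.cast_sub hFk, mul_div_assoc,
    ← Real.exp_sub, mul_comm, div_eq_mul_inv (2 ^ k : ℝ)]
  refine mul_le_mul_of_nonneg_right (Real.exp_le_exp.2 ?_) (by positivity)
  have : 0 ≤ (F.card : ℝ) * lam ^ 2 := by positivity
  nlinarith

end DecisionTree

-- Pair the two inputs with index `a` and values `0`, `1`. A tree that never looks near `a` answers
-- both alike and is right on exactly one, so a tree of height `h` succeeds on at most `2 ^ k * (1 +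
-- h * δ)` of the `2 * 2 ^ k` inputs, whereas two thirds are required.
open DecisionTree in
open Classical in
theorem one_third_le_of_subcube_bound {k : ℕ} (hk : ∀ a : Fin k → Bool, CloseIndex a a) {δ : ℝ}
    (hδ : 0 ≤ δ) (hc : ∀ (F : Finset (Fin k)) (σ b : Fin k → Bool),
      F.card ≤ randQuery (approxIndex k) →
      (((subcube F σ).filter fun a => CloseIndex a b).card : ℝ) ≤ δ * (2 ^ k / 2 ^ F.card)) :
    1 / 3 ≤ randQuery (approxIndex k) * δ := by
  obtain ⟨T, hT, hf⟩ := exists_randQuery (approxIndex k)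
  set h := randQuery (approxIndex k)
  have key := T.sum_prob_le (Finset.univ : Finset ((Fin k → Bool) × Bool)) (fun _ => 1)
    (fun j => indexInput j.1 j.2) (fun j => j.2) (2 ^ k + h * (δ * 2 ^ k)) ?_
  · have h1 : ∑ j : (Fin k → Bool) × Bool, (2 / 3 : ℝ) ≤
        ∑ j : (Fin k → Bool) × Bool, 1 * T.prob (indexInput j.1 j.2) j.2 := by
      refine Finset.sum_le_sum fun j _ => ?_
      have := hf _ _ (approxIndex_indexInput j.1 j.2 (hk j.1))
      linarith
    have h2 : ∑ j : (Fin k → Bool) × Bool, (2 / 3 : ℝ) = 2 ^ k * (4 / 3) := by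
      simp; ring
    have h3 : (0 : ℝ) < 2 ^ k := by positivity
    have h4 : (2 ^ k : ℝ) * (1 / 3) ≤ 2 ^ k * (h * δ) := by linarith
    exact le_of_mul_le_mul_left h4 h3
  · intro D hD
    have hDh : (D.height : ℝ) ≤ h := by exact_mod_cast hT D hD
    have hDh' : D.height ≤ h := hT D hD
    have hcount := card_hits_le hδ hc D ∅ (fun _ => false) (by simpa using hDh')
    have huniv : subcube ∅ (fun _ : Fin k => false) = Finset.univ := by simp [subcube]
    rw [huniv] at hcount
    simp only [Finset.card_empty, pow_zero, div_one] at hcount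
    have hcount' : ((Finset.univ.filter fun a => D.Hits a).card : ℝ) ≤ h * (δ * 2 ^ k) :=
      hcount.trans (by gcongr)
    rw [Fintype.sum_prod_type]
    calc _ ≤ ∑ a : Fin k → Bool, (1 + if D.Hits a then (1 : ℝ) else 0) := by
          refine Finset.sum_le_sum fun a _ => ?_
          rw [Fintype.sum_bool]
          by_cases ha : D.Hits a
          · simp only [ha, if_true]
            split_ifs <;> norm_num
          · simp only [eval_indexInput D a _ ha, ha]
            cases D.eval (blankInput a) <;> simp
      _ = 2 ^ k + (Finset.univ.filter fun a => D.Hits a).card := by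
          rw [Finset.sum_add_distrib, Finset.sum_boole]; simp
      _ ≤ _ := by linarith

theorem tendsto_logb_two_nat : Tendsto (fun k : ℕ => Real.logb 2 k) atTop atTop :=
  (Real.tendsto_logb_atTop one_lt_two).comp tendsto_natCast_atTop_atTop

theorem eventually_mul_logb_two_le (C : ℝ) :
    ∀ᶠ k : ℕ in atTop, C * Real.logb 2 k ≤ k := by
  have h : (fun x : ℝ => C * Real.logb 2 x) =o[atTop] fun x => x := by
    simp only [Real.logb, div_eq_inv_mul]
    exact (Real.isLittleO_log_id_atTop.const_mul_left _).const_mul_left _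
  have h2 := (h.bound one_pos).and (eventually_ge_atTop (0 : ℝ))
  filter_upwards [tendsto_natCast_atTop_atTop.eventually h2] with k hk
  have := (Real.le_norm_self _).trans hk.1
  simpa using this

theorem natCast_le_exp_logb (k : ℕ) (hk : 1 ≤ k) : (k : ℝ) ≤ Real.exp (Real.logb 2 k) := by
  have hk' : (1 : ℝ) ≤ k := by exact_mod_cast hk
  conv_lhs => rw [← Real.exp_log (by linarith : (0 : ℝ) < k)]
  apply Real.exp_le_exp.2
  rw [Real.logb, le_div_iff₀ (Real.log_pos one_lt_two)]
  have := Real.log_nonneg hk'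
  have := Real.log_two_lt_d9
  nlinarith

open DecisionTree in
theorem eventually_lt_randQuery_approxIndex :
    ∀ᶠ k : ℕ in atTop, √(k * Real.logb 2 k) < randQuery (approxIndex k) := by
  classical
  filter_upwards [eventually_mul_logb_two_le 16, tendsto_logb_two_nat.eventually_ge_atTop 1,
    eventually_ge_atTop 1] with k h16 hL hk
  by_contra! hlt
  set L := Real.logb 2 (k : ℝ) with hLdef
  have hk' : (1 : ℝ) ≤ k := by exact_mod_cast hk
  set R := √(k * L) with hR
  have hR0 : 0 ≤ R := Real.sqrt_nonneg _
  have hR2 : R ^ 2 = k * L := Real.sq_sqrt (by positivity)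
  have hR4 : 4 * R ≤ k := by nlinarith
  -- Fewer than `k ≤ exp L` queries, each hitting with probability `exp (-4 * L)`, stay below `1 /
  -- 3`.
  have key := one_third_le_of_subcube_bound (k := k) (δ := Real.exp (-4 * L)) ?_
    (Real.exp_pos _).le ?_
  · have h1 : (randQuery (approxIndex k) : ℝ) * Real.exp (-4 * L) ≤ Real.exp (-3 * L) := by
      calc _ ≤ Real.exp L * Real.exp (-4 * L) := by
            gcongr
            have := natCast_le_exp_logb k hk
            linarith
        _ = _ := by rw [← Real.exp_add]; ring_nf
    have h2 : Real.exp (-3 * L) ≤ 1 / 4 := by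
      have h := Real.add_one_le_exp (3 * L)
      have e : Real.exp (-3 * L) = (Real.exp (3 * L))⁻¹ := by rw [← Real.exp_neg]; ring_nf
      rw [e, one_div]
      exact inv_anti₀ (by norm_num) (by linarith)
    linarith
  · intro a
    simp only [CloseIndex, hammingDist_self, Nat.cast_zero]
    rw [← hLdef, ← hR]
    linarith
  · intro F σ b hF
    have hF' : (F.card : ℝ) ≤ R := le_trans (by exact_mod_cast hF) hlt
    -- With `lam = 4 * R / k` the three terms of the exponent are `-8 * L`, at most `2 * L` (from
    -- the known bits) and `2 * L`.
    refine (card_close_le F σ b (4 * R / k) (2 * R) (by positivity)).trans ?_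
    refine mul_le_mul_of_nonneg_right (Real.exp_le_exp.2 ?_) (by positivity)
    have e1 : k * (4 * R / k) ^ 2 / 8 = 2 * L := by
      field_simp; rw [hR2]; ring
    have e2 : R * (4 * R / k) = 4 * L := by
      field_simp; rw [hR2]
    have e3 : 4 * R / k * F.card ≤ R * (4 * R / k) := by
      rw [mul_comm]; gcongr
    rw [e1]
    linarith

/-! ### Advantage of the majority of biased samples -/

/-- The expectation of `φ` at the end of a walk of `n` steps from `s`, each of them `1` with
probability `p` and `-1` otherwise. -/
def walkMean (p : ℝ) : ℕ → (ℤ → ℝ) → ℤ → ℝ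
  | 0, φ, s => φ s
  | n + 1, φ, s => p * walkMean p n φ (s + 1) + (1 - p) * walkMean p n φ (s - 1)

theorem walkMean_succ' (p : ℝ) (n : ℕ) (φ : ℤ → ℝ) (s : ℤ) : walkMean p (n + 1) φ s =
    walkMean p n (fun t => p * φ (t + 1) + (1 - p) * φ (t - 1)) s := by
  induction n generalizing s with
  | zero => rfl
  | succ n ih => rw [walkMean, ih, ih, ← walkMean]

theorem walkMean_eq_sum (p : ℝ) (n : ℕ) (φ : ℤ → ℝ) (s : ℤ) : walkMean p n φ s =
    ∑ i ∈ Finset.range (n + 1), (n.choose i : ℝ) * (p ^ i * (1 - p) ^ (n - i)) *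
      φ (s + 2 * i - n) := by
  induction n generalizing s with
  | zero => simp [walkMean]
  | succ n ih =>
    have hL : ∑ i ∈ Finset.range (n + 1), (n.choose i : ℝ) *
        (p ^ i * (1 - p) ^ (n - i)) * φ (s + 1 + 2 * i - n) * p =
        ∑ i ∈ Finset.range (n + 1), (n.choose i : ℝ) *
          (p ^ (i + 1) * (1 - p) ^ (n + 1 - (i + 1))) *
            φ (s + 2 * (i + 1 : ℕ) - (n + 1 : ℕ)) := by
      refine Finset.sum_congr rfl fun i _ => ?_
      rw [show s + 2 * ((i + 1 : ℕ) : ℤ) - ((n + 1 : ℕ) : ℤ) = s + 1 + 2 * i - n by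
        push_cast; ring, Nat.add_sub_add_right]
      ring
    have hR : ∑ i ∈ Finset.range (n + 1), (n.choose i : ℝ) *
        (p ^ i * (1 - p) ^ (n - i)) * φ (s - 1 + 2 * i - n) * (1 - p) =
        ∑ i ∈ Finset.range (n + 1), (n.choose i : ℝ) *
          (p ^ i * (1 - p) ^ (n + 1 - i)) * φ (s + 2 * i - (n + 1 : ℕ)) := by
      refine Finset.sum_congr rfl fun i hi => ?_
      rw [show s + 2 * (i : ℤ) - ((n + 1 : ℕ) : ℤ) = s - 1 + 2 * i - n by
        push_cast; ring, Nat.succ_sub (Finset.mem_range_succ_iff.1 hi), pow_succ]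
      ring
    rw [walkMean, ih, ih, mul_comm p, mul_comm (1 - p), Finset.sum_mul, Finset.sum_mul, hL, hR,
      Finset.sum_range_succ' _ (n + 1)]
    simp only [Nat.choose_succ_succ', Nat.cast_add, add_mul, Finset.sum_add_distrib]
    rw [add_assoc]
    congr 1
    rw [Finset.sum_range_succ' _ n, Finset.sum_range_succ _ n]
    simp

/-- After an odd number of steps, two further steps change the sign only from `-1` (both up) or from
`1` (both down). The net change is `2 * C(2m+1, m) * (p(1-p))^(m+1) * (2p - 1)`, which is the next
term of the sum. -/
theorem walkMean_sign (p : ℝ) (m : ℕ) : walkMean p (2 * m + 1) (fun s => (s.sign : ℝ)) 0 =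
    (2 * p - 1) * ∑ j ∈ Finset.range (m + 1), (j.centralBinom : ℝ) * (p * (1 - p)) ^ j := by
  induction m with
  | zero => simp [walkMean]; ring
  | succ m ih =>
    have hstep : ∀ i ∈ Finset.range (2 * m + 1 + 1),
        p * (p * (((0 + 2 * i - (2 * m + 1 : ℕ) + 1 + 1 : ℤ).sign : ℤ) : ℝ) +
          (1 - p) * (((0 + 2 * i - (2 * m + 1 : ℕ) + 1 - 1 : ℤ).sign : ℤ) : ℝ)) +
        (1 - p) * (p * (((0 + 2 * i - (2 * m + 1 : ℕ) - 1 + 1 : ℤ).sign : ℤ) : ℝ) +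
          (1 - p) * (((0 + 2 * i - (2 * m + 1 : ℕ) - 1 - 1 : ℤ).sign : ℤ) : ℝ)) =
        ((0 + 2 * i - (2 * m + 1 : ℕ) : ℤ).sign : ℝ) + (if m = i then 2 * p ^ 2 else 0) -
          (if m + 1 = i then 2 * (1 - p) ^ 2 else 0) := by
      intro i _
      have s1 : ∀ z : ℤ, 0 < z → ((z.sign : ℤ) : ℝ) = 1 := fun z hz => by
        rw [Int.sign_eq_one_of_pos hz]; simp
      have s2 : ∀ z : ℤ, z < 0 → ((z.sign : ℤ) : ℝ) = -1 := fun z hz => by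
        rw [Int.sign_eq_neg_one_of_neg hz]; simp
      push_cast
      rcases lt_trichotomy i m with h | h | h
      · rw [s2 _ (by omega), s2 _ (by omega), s2 _ (by omega), s2 _ (by omega), s2 _ (by omega),
          if_neg (by omega), if_neg (by omega)]
        ring
      · rw [s1 _ (by omega), s2 _ (by omega), s2 _ (by omega), s2 _ (by omega), s2 _ (by omega),
          if_pos (by omega), if_neg (by omega)]
        ring
      · rcases (Nat.succ_le_of_lt h).eq_or_lt with h | h
        · rw [s1 _ (by omega), s1 _ (by omega), s1 _ (by omega), s2 _ (by omega),
            s1 _ (by omega), if_neg (by omega), if_pos (by omega)]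
          ring
        · rw [s1 _ (by omega), s1 _ (by omega), s1 _ (by omega), s1 _ (by omega),
            s1 _ (by omega), if_neg (by omega), if_neg (by omega)]
          ring
    have hc : 2 * ((2 * m + 1).choose m : ℝ) = ((m + 1).centralBinom : ℝ) := by
      have h1 : (m + 1).centralBinom = (2 * m + 1).choose m + (2 * m + 1).choose (m + 1) := by
        rw [Nat.centralBinom_eq_two_mul_choose, show 2 * (m + 1) = 2 * m + 1 + 1 by ring,
          Nat.choose_succ_succ']
      have h2 : (2 * m + 1).choose (m + 1) = (2 * m + 1).choose m :=
        Nat.choose_symm_half m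
      rw [h1, h2]; push_cast; ring
    have hc' : ((2 * m + 1).choose (m + 1) : ℝ) = ((2 * m + 1).choose m : ℝ) := by
      exact_mod_cast Nat.choose_symm_half m
    rw [Finset.sum_range_succ, mul_add (2 * p - 1), ← ih, show 2 * (m + 1) + 1 = 2 * m + 1 + 1 + 1 by ring,
      walkMean_succ', walkMean_succ', walkMean_eq_sum, walkMean_eq_sum,
      Finset.sum_congr rfl fun i hi => congrArg _ (hstep i hi)]
    simp only [mul_add, mul_sub, Finset.sum_add_distrib, Finset.sum_sub_distrib, mul_ite, mul_zero,
      Finset.sum_ite_eq, Finset.mem_range]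
    rw [if_pos (by omega), if_pos (by omega), hc', show 2 * m + 1 - m = m + 1 by omega,
      show 2 * m + 1 - (m + 1) = m by omega, ← hc,
      show p * 1 - p * p = p * (1 - p) by ring, mul_pow]
    ring

theorem sixteen_pow_le_centralBinom (m : ℕ) (hm : 1 ≤ m) :
    (16 : ℝ) ^ m ≤ 4 * m * (m.centralBinom : ℝ) ^ 2 := by
  induction m, hm using Nat.le_induction with
  | base => norm_num [Nat.centralBinom]
  | succ m hm ih =>
    have h : ((m : ℝ) + 1) * (m + 1).centralBinom = 2 * (2 * m + 1) * m.centralBinom := by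
      exact_mod_cast Nat.succ_mul_centralBinom_succ m
    have hm' : (0 : ℝ) < m + 1 := by positivity
    have h2 : ((m : ℝ) + 1) ^ 2 * ((m + 1).centralBinom : ℝ) ^ 2 =
        4 * (2 * m + 1) ^ 2 * (m.centralBinom : ℝ) ^ 2 := by
      rw [← mul_pow, h]; ring
    have h3 : (0 : ℝ) ≤ (m.centralBinom : ℝ) ^ 2 := by positivity
    push_cast
    refine le_of_mul_le_mul_left ?_ hm'
    calc ((m : ℝ) + 1) * 16 ^ (m + 1) = 16 * (m + 1) * 16 ^ m := by ring
      _ ≤ 16 * (m + 1) * (4 * m * (m.centralBinom : ℝ) ^ 2) := by gcongr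
      _ ≤ 4 * (4 * (2 * m + 1) ^ 2 * (m.centralBinom : ℝ) ^ 2) := by nlinarith
      _ = 4 * (((m : ℝ) + 1) ^ 2 * ((m + 1).centralBinom : ℝ) ^ 2) := by rw [h2]
      _ = _ := by ring

/-- While the bias is small, Bernoulli's inequality keeps `(4p(1-p))^j ≥ 1/2`, and the central
binomial estimate makes each of the `m + 1` terms at least `1 / (4√m)`. -/
theorem le_walkMean_sign {p : ℝ} (hp : 1 / 2 ≤ p) {m : ℕ} (hm : 1 ≤ m)
    (hpm : m * (2 * p - 1) ^ 2 ≤ 1 / 2) :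
    (2 * p - 1) * (√m / 4) ≤ walkMean p (2 * m + 1) (fun s => (s.sign : ℝ)) 0 := by
  rw [walkMean_sign]
  refine mul_le_mul_of_nonneg_left ?_ (by linarith)
  have hm' : (1 : ℝ) ≤ m := by exact_mod_cast hm
  have hs1 : 1 ≤ √(m : ℝ) := Real.one_le_sqrt.2 hm'
  have hsm : √(m : ℝ) ^ 2 = m := Real.sq_sqrt (by positivity)
  set δ := (2 * p - 1) ^ 2 with hδ
  have hδ0 : 0 ≤ δ := sq_nonneg _
  have hδ1 : δ ≤ 1 := by nlinarith
  have hpq : p * (1 - p) = (1 - δ) / 4 := by rw [hδ]; ring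
  have hterm : ∀ j ∈ Finset.range (m + 1), 1 / (4 * √(m : ℝ)) ≤
      (j.centralBinom : ℝ) * (p * (1 - p)) ^ j := by
    intro j hj
    have hj : j ≤ m := Finset.mem_range_succ_iff.1 hj
    have h1 : (1 / 2 : ℝ) ≤ (1 - δ) ^ j := by
      calc (1 / 2 : ℝ) ≤ 1 + (m : ℝ) * (-δ) := by linarith
        _ ≤ (1 + -δ) ^ m := one_add_mul_le_pow (by linarith) m
        _ = (1 - δ) ^ m := by ring
        _ ≤ (1 - δ) ^ j := pow_le_pow_of_le_one (by linarith) (by linarith) hj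
    have h2 : 1 / (2 * √(m : ℝ)) ≤ (j.centralBinom : ℝ) / 4 ^ j := by
      rcases Nat.eq_zero_or_pos j with rfl | hj0
      · simp only [Nat.centralBinom_zero, Nat.cast_one, pow_zero, div_one]
        rw [div_le_one (by positivity)]; linarith
      · rw [div_le_div_iff₀ (by positivity) (by positivity), one_mul]
        refine le_of_sq_le_sq ?_ (by positivity)
        calc ((4 : ℝ) ^ j) ^ 2 = 16 ^ j := by rw [← pow_mul, mul_comm, pow_mul]; norm_num
          _ ≤ 4 * j * (j.centralBinom : ℝ) ^ 2 := sixteen_pow_le_centralBinom j hj0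
          _ ≤ 4 * m * (j.centralBinom : ℝ) ^ 2 := by gcongr
          _ = _ := by rw [mul_pow, mul_pow, hsm]; ring
    calc 1 / (4 * √(m : ℝ)) = 1 / (2 * √(m : ℝ)) * (1 / 2) := by field_simp; norm_num
      _ ≤ (j.centralBinom : ℝ) / 4 ^ j * (1 - δ) ^ j := by gcongr
      _ = _ := by rw [hpq, div_pow]; ring
  calc √(m : ℝ) / 4 ≤ (m + 1) * (1 / (4 * √(m : ℝ))) := by
        rw [mul_one_div, div_le_div_iff₀ (by norm_num) (by positivity)]
        nlinarith
    _ = ∑ j ∈ Finset.range (m + 1), 1 / (4 * √(m : ℝ)) := by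
        rw [Finset.sum_const, Finset.card_range, nsmul_eq_mul]; push_cast; ring
    _ ≤ _ := Finset.sum_le_sum hterm

theorem sum_samples_eq_walkMean {k : ℕ} (hk : 0 < k) (u : Fin k → Prop) [DecidablePred u]
    (n : ℕ) (φ : ℤ → ℝ) (s : ℤ) :
    ∑ ρ : Fin n → Fin k, φ (s + ∑ t, if u (ρ t) then 1 else -1) =
      (k : ℝ) ^ n * walkMean (((Finset.univ.filter u).card : ℝ) / k) n φ s := by
  have hk' : (k : ℝ) ≠ 0 := by exact_mod_cast hk.ne'
  induction n generalizing s with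
  | zero => simp [walkMean]
  | succ n ih =>
    rw [← (Fin.consEquiv fun _ => Fin k).sum_comp, Fintype.sum_prod_type]
    have h : ∀ j : Fin k, ∑ ρ : Fin n → Fin k,
        φ (s + ∑ t, if u (Fin.consEquiv (fun _ => Fin k) (j, ρ) t) then 1 else -1) =
        if u j then (k : ℝ) ^ n * walkMean (((Finset.univ.filter u).card : ℝ) / k) n φ (s + 1)
        else (k : ℝ) ^ n * walkMean (((Finset.univ.filter u).card : ℝ) / k) n φ (s - 1) := by
      intro j
      simp only [Fin.consEquiv_apply, Fin.sum_univ_succ, Fin.cons_zero, Fin.cons_succ, ← add_assoc]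
      split_ifs
      · exact ih _
      · exact ih _
    have hcard : ((Finset.univ.filter fun j => ¬ u j).card : ℝ) =
        k - (Finset.univ.filter u).card := by
      rw [eq_sub_iff_add_eq, add_comm]
      have := Finset.card_filter_add_card_filter_not (s := (Finset.univ : Finset (Fin k))) u
      rw [Finset.card_univ, Fintype.card_fin] at this
      exact_mod_cast this
    rw [Finset.sum_congr rfl fun j _ => h j, Finset.sum_ite, Finset.sum_const, Finset.sum_const,
      nsmul_eq_mul, nsmul_eq_mul, hcard, walkMean]
    field_simp
    ring

/-- The majority of the bits of `x` at the sampled positions. -/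
def sampleMaj {k q : ℕ} (ρ : Fin q → Fin k) (x : Fin k → Bool) : Bool :=
  decide (q < 2 * (Finset.univ.filter fun t => x (ρ t) = true).card)

/-- Counting agreements with `c` as `1` and disagreements as `-1` gives the biased walk. The odd
sample size excludes ties, so a wrong majority means a negative sign. -/
theorem card_sampleMaj_ne_le {k m : ℕ} (hk : 0 < k) (x : Fin k → Bool) (c : Bool) {p : ℝ}
    (hpk : p = ((Finset.univ.filter fun j => x j = c).card : ℝ) / k) (hp : 1 / 2 ≤ p)
    (hm : 1 ≤ m) (hpm : m * (2 * p - 1) ^ 2 ≤ 1 / 2) :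
    ((Finset.univ.filter fun ρ : Fin (2 * m + 1) → Fin k => sampleMaj ρ x ≠ c).card : ℝ) ≤
      (k : ℝ) ^ (2 * m + 1) * (1 / 2 - (2 * p - 1) * (√m / 8)) := by
  have h1 := le_walkMean_sign hp hm hpm
  have h2 := sum_samples_eq_walkMean hk (fun j => x j = c) (2 * m + 1)
    (fun s => (s.sign : ℝ)) 0
  rw [← hpk] at h2
  have h3 : ∑ ρ : Fin (2 * m + 1) → Fin k,
      (((0 + ∑ t, if x (ρ t) = c then 1 else -1 : ℤ).sign : ℤ) : ℝ) ≤
      ∑ ρ : Fin (2 * m + 1) → Fin k, (1 - 2 * if sampleMaj ρ x ≠ c then (1 : ℝ) else 0) := by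
    refine Finset.sum_le_sum fun ρ _ => ?_
    have hsum : (Finset.univ.filter fun t => x (ρ t) = c).card +
        (Finset.univ.filter fun t => ¬ x (ρ t) = c).card = 2 * m + 1 := by
      rw [Finset.card_filter_add_card_filter_not]; simp
    have hS : (0 + ∑ t, if x (ρ t) = c then 1 else -1 : ℤ) =
        (Finset.univ.filter fun t => x (ρ t) = c).card -
          (Finset.univ.filter fun t => ¬ x (ρ t) = c).card := by
      rw [zero_add, Finset.sum_ite]; simp; ring
    split_ifs with hne
    · have hneg : (0 + ∑ t, if x (ρ t) = c then 1 else -1 : ℤ) < 0 := by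
        rw [hS]
        cases c
        · simp only [sampleMaj, ne_eq, decide_eq_false_iff_not, not_not,
            Bool.not_eq_false] at hne hsum ⊢
          omega
        · simp only [sampleMaj, ne_eq, decide_eq_true_eq] at hne
          omega
      rw [Int.sign_eq_neg_one_of_neg hneg]; norm_num
    · simp only [mul_zero, sub_zero]
      have : ((0 + ∑ t, if x (ρ t) = c then 1 else -1 : ℤ)).sign ≤ 1 := by
        rcases Int.sign_trichotomy (0 + ∑ t, if x (ρ t) = c then 1 else -1 : ℤ) with h | h | h <;>
          rw [h] <;> norm_num
      exact_mod_cast this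
  rw [h2, Finset.sum_sub_distrib, ← Finset.mul_sum, Finset.sum_boole] at h3
  simp only [Finset.sum_const, Finset.card_univ, Fintype.card_pi, Fintype.card_fin,
    Finset.prod_const, nsmul_eq_mul, mul_one, Nat.cast_pow] at h3
  have h4 := mul_le_mul_of_nonneg_left h1 (by positivity : (0 : ℝ) ≤ (k : ℝ) ^ (2 * m + 1))
  linarith

/-! ### The algorithm for the composition -/

/-- A Chernoff bound for the number of failures among `k` independent experiments. -/
theorem card_many_failures_le {k : ℕ} {P : Type*} [Fintype P] (wrong : Fin k → P → Prop)
    [∀ i, DecidablePred (wrong i)] {μ lam T : ℝ} (h0 : 0 ≤ lam) (h1 : lam ≤ 1)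
    (hμ : ∀ i, ((Finset.univ.filter (wrong i)).card : ℝ) ≤ Fintype.card P * μ) :
    ((Finset.univ.filter fun r : Fin k → P =>
      T < ((Finset.univ.filter fun i => wrong i (r i)).card : ℝ)).card : ℝ) ≤
      (Fintype.card P : ℝ) ^ k * Real.exp (k * (μ * (lam + lam ^ 2)) - lam * T) := by
  have hexp : Real.exp lam - 1 ≤ lam + lam ^ 2 := by
    have := (abs_le.1 (Real.abs_exp_sub_one_sub_id_le (x := lam) (by rwa [abs_of_nonneg h0]))).2
    linarith
  have hexp0 : 0 ≤ Real.exp lam - 1 := by linarith [Real.add_one_le_exp lam]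
  have hfac : ∀ i, ∑ ρ : P, (if wrong i ρ then Real.exp lam else 1) ≤
      Fintype.card P * Real.exp (μ * (lam + lam ^ 2)) := by
    intro i
    have hcard : ((Finset.univ.filter fun ρ => ¬ wrong i ρ).card : ℝ) =
        Fintype.card P - (Finset.univ.filter (wrong i)).card := by
      rw [eq_sub_iff_add_eq, add_comm]
      exact_mod_cast Finset.card_filter_add_card_filter_not (s := Finset.univ) (wrong i)
    rw [Finset.sum_ite, Finset.sum_const, Finset.sum_const, nsmul_eq_mul, nsmul_eq_mul, hcard]
    have hc0 : (0 : ℝ) ≤ (Finset.univ.filter (wrong i)).card := Nat.cast_nonneg _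
    have hP0 : (0 : ℝ) ≤ Fintype.card P := Nat.cast_nonneg _
    calc _ = Fintype.card P +
          ((Finset.univ.filter (wrong i)).card : ℝ) * (Real.exp lam - 1) := by ring
      _ ≤ Fintype.card P + ((Finset.univ.filter (wrong i)).card : ℝ) * (lam + lam ^ 2) := by
          gcongr
      _ ≤ Fintype.card P + Fintype.card P * μ * (lam + lam ^ 2) := by
          gcongr; exact hμ i
      _ = Fintype.card P * (μ * (lam + lam ^ 2) + 1) := by ring
      _ ≤ _ := by gcongr; exact Real.add_one_le_exp _
  have hprod : ∀ r ∈ Finset.univ.filter fun r : Fin k → P =>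
      T < ((Finset.univ.filter fun i => wrong i (r i)).card : ℝ),
      Real.exp (lam * T) ≤ ∏ i, if wrong i (r i) then Real.exp lam else 1 := by
    intro r hr
    rw [Finset.prod_ite, Finset.prod_const_one, mul_one, Finset.prod_const, ← Real.exp_nat_mul]
    apply Real.exp_le_exp.2
    have := (Finset.mem_filter.1 hr).2
    nlinarith
  have key : ((Finset.univ.filter fun r : Fin k → P =>
      T < ((Finset.univ.filter fun i => wrong i (r i)).card : ℝ)).card : ℝ) *
        Real.exp (lam * T) ≤ (Fintype.card P * Real.exp (μ * (lam + lam ^ 2))) ^ k := by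
    rw [← nsmul_eq_mul, ← Finset.sum_const]
    calc _ ≤ ∑ r ∈ Finset.univ.filter fun r : Fin k → P =>
          T < ((Finset.univ.filter fun i => wrong i (r i)).card : ℝ),
          ∏ i, (if wrong i (r i) then Real.exp lam else 1) := Finset.sum_le_sum hprod
      _ ≤ ∑ r : Fin k → P, ∏ i, (if wrong i (r i) then Real.exp lam else 1) :=
          Finset.sum_le_sum_of_subset_of_nonneg (Finset.subset_univ _)
            fun r _ _ => Finset.prod_nonneg fun i _ => by positivity
      _ = ∏ i, ∑ ρ : P, (if wrong i ρ then Real.exp lam else 1) := by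
          rw [Finset.prod_univ_sum, Fintype.piFinset_univ]
      _ ≤ ∏ i : Fin k, Fintype.card P * Real.exp (μ * (lam + lam ^ 2)) :=
          Finset.prod_le_prod (fun i _ => Finset.sum_nonneg fun ρ _ => by positivity)
            fun i _ => hfac i
      _ = _ := by simp
  rw [← le_div_iff₀ (Real.exp_pos _)] at key
  refine key.trans_eq ?_
  rw [mul_pow, ← Real.exp_nat_mul, mul_div_assoc, ← Real.exp_sub]

theorem card_eq_of_gapMaj {m : ℕ} {x : Fin m → Bool} {c : Bool} (h : gapMaj m x = some c) :
    (m : ℝ) / 2 + 2 * √(m : ℝ) ≤ (Finset.univ.filter fun j => x j = c).card ∧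
      ((Finset.univ.filter fun j => x j = c).card : ℝ) ≤ m / 2 + 2 * √(m : ℝ) + 1 := by
  simp only [gapMaj] at h
  split_ifs at h with h1 h0
  · obtain rfl : true = c := by simpa using h
    have e : ((Finset.univ.filter fun j => x j = true).card : ℝ) =
        ((⌈(m : ℝ) / 2 + 2 * √(m : ℝ)⌉ : ℤ) : ℝ) := by exact_mod_cast h1
    rw [e]
    exact ⟨Int.le_ceil _, (Int.ceil_lt_add_one _).le⟩
  · obtain rfl : false = c := by simpa using h
    have e : ((Finset.univ.filter fun j => x j = true).card : ℝ) =
        ((⌊(m : ℝ) / 2 - 2 * √(m : ℝ)⌋ : ℤ) : ℝ) := by exact_mod_cast h0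
    have hs : ((Finset.univ.filter fun j => x j = true).card : ℝ) +
        (Finset.univ.filter fun j => x j = false).card = m := by
      have := Finset.card_filter_add_card_filter_not (s := (Finset.univ : Finset (Fin m)))
        (fun j => x j = true)
      simp only [Bool.not_eq_true, Finset.card_univ, Fintype.card_fin] at this
      exact_mod_cast this
    have := Int.floor_le ((m : ℝ) / 2 - 2 * √(m : ℝ))
    have := Int.lt_floor_add_one ((m : ℝ) / 2 - 2 * √(m : ℝ))
    constructor <;> linarith

theorem PartialBoolFn.comp_eq_some {ι κ : Type*} [Fintype ι] {f : PartialBoolFn ι}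
    {g : PartialBoolFn κ} {x : ι × κ → Bool} {v : Bool} (h : f.comp g x = some v) :
    ∃ y, (∀ i, g (fun j => x (i, j)) = some (y i)) ∧ f y = some v := by
  simp only [PartialBoolFn.comp] at h
  split_ifs at h with hs
  exact ⟨_, fun i => (Option.some_get (hs i)).symm, h⟩

/-- The low bit of the code of a letter `0` or `1` is its value. -/
theorem decide_decodeTrit_eq_one {u w : Bool} (hs : (decodeTrit u w).isSome)
    (h : (decodeTrit u w).get hs = 0 ∨ (decodeTrit u w).get hs = 1) :
    decide ((decodeTrit u w).get hs = 1) = w := by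
  cases u <;> cases w <;> simp_all [decodeTrit]

theorem approxIndex_eq_some {k : ℕ} {y : Fin k ⊕ (Fin k → Bool) × Fin 2 → Bool} {v : Bool}
    (h : approxIndex k y = some v) (b : Fin k → Bool) (hb : CloseIndex (fun i => y (.inl i)) b) :
    y (.inr (b, 1)) = v := by
  simp only [approxIndex] at h
  split_ifs at h with hs
  simp only [approxIndexTernary] at h
  split_ifs at h with hx
  obtain ⟨ha, hc, -⟩ := hx
  simp only [Option.some.injEq, ← hc b hb] at h ha
  exact (decide_decodeTrit_eq_one (hs b) ha).symm.trans h

/-- Guess the index from the majorities of the sampled bits of its blocks, and evaluate the low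
bit of the entry at the guessed position. -/
noncomputable def guessTree (k q : ℕ) (r : Fin k → Fin q → Fin k) :
    DecisionTree ((Fin k ⊕ (Fin k → Bool) × Fin 2) × Fin k) :=
  .queryAll (fun y => .queryAll
      (fun z => .leaf ((gapMaj k fun j =>
        z (.inr (fun i => sampleMaj (r i) fun j => y (.inl i, j), 1), j)).getD false))
      ((Finset.univ : Finset (Fin k)).toList.map fun j =>
        (.inr (fun i => sampleMaj (r i) fun j => y (.inl i, j), 1), j)) fun _ => false)
    ((Finset.univ : Finset (Fin k × Fin q)).toList.map fun t => (.inl t.1, r t.1 t.2))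
    fun _ => false

theorem height_guessTree_le (k q : ℕ) (r : Fin k → Fin q → Fin k) :
    (guessTree k q r).height ≤ k * q + k := by
  refine (DecisionTree.height_queryAll_le _ _ _ k fun y => ?_).trans_eq (by simp)
  refine (DecisionTree.height_queryAll_le _ _ _ 0 fun z => ?_).trans_eq (by simp)
  simp [DecisionTree.height]

theorem eval_guessTree (k q : ℕ) (r : Fin k → Fin q → Fin k)
    (x : (Fin k ⊕ (Fin k → Bool) × Fin 2) × Fin k → Bool) :
    (guessTree k q r).eval x = (gapMaj k fun j =>
      x (.inr (fun i => sampleMaj (r i) fun j => x (.inl i, j), 1), j)).getD false := by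
  classical
  have hq : ∀ i t, (Sum.inl i, r i t) ∈ ((Finset.univ : Finset (Fin k × Fin q)).toList.map
      fun t => ((Sum.inl t.1, r t.1 t.2) : (Fin k ⊕ (Fin k → Bool) × Fin 2) × Fin k)) := by
    intro i t
    rw [List.mem_map]
    exact ⟨(i, t), by simp, rfl⟩
  simp only [guessTree, DecisionTree.eval_queryAll, DecisionTree.eval, sampleMaj, hq, if_true]
  congr 2
  funext j
  rw [if_pos]
  rw [List.mem_map]
  exact ⟨j, by simp, rfl⟩

theorem eventually_randQuery_comp_le : ∀ᶠ k : ℕ in atTop,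
    (randQuery ((approxIndex k).comp (gapMaj k)) : ℝ) ≤ 76 * (k * Real.logb 2 k) := by
  classical
  filter_upwards [eventually_mul_logb_two_le 1850, tendsto_logb_two_nat.eventually_ge_atTop 4,
    eventually_ge_atTop 1] with k hkL hL hk
  have hk' : (1 : ℝ) ≤ k := by exact_mod_cast hk
  set L := Real.logb 2 (k : ℝ) with hLdef
  -- Then `√m ≥ 6√L`, and a bias `2p - 1 ≥ 4/√k` yields the advantage `(4/√k) * √m / 8 ≥ 3 * R / k`.
  set m := ⌈36 * L⌉₊ with hm
  have hm1 : 36 * L ≤ m := Nat.le_ceil _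
  have hm2 : (m : ℝ) ≤ 37 * L := by
    have := Nat.ceil_lt_add_one (by linarith : 0 ≤ 36 * L)
    linarith
  have hm0 : 1 ≤ m := by
    have : (1 : ℝ) ≤ m := by linarith
    exact_mod_cast this
  have : Nonempty (Fin k) := ⟨⟨0, hk⟩⟩
  set R := √(k * L) with hR
  have hR0 : 0 ≤ R := Real.sqrt_nonneg _
  have hR2 : R ^ 2 = k * L := Real.sq_sqrt (by positivity)
  have hRk : R ≤ k := by
    refine le_of_sq_le_sq ?_ (by positivity)
    rw [hR2]; nlinarith
  set s := √(k : ℝ) with hs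
  have hs2 : s ^ 2 = k := Real.sq_sqrt (by positivity)
  have hs0 : 0 < s := Real.sqrt_pos.2 (by linarith)
  have hs85 : 85 ≤ s := Real.le_sqrt_of_sq_le (by nlinarith)
  have hbound : randQuery ((approxIndex k).comp (gapMaj k)) ≤ k * (2 * m + 1) + k := by
    refine randQuery_le_of_family _ (guessTree k (2 * m + 1)) _ (height_guessTree_le k _) ?_
    intro x v hx
    obtain ⟨y, hy, hv⟩ := PartialBoolFn.comp_eq_some hx
    have hμ : ∀ i : Fin k, ((Finset.univ.filter fun ρ : Fin (2 * m + 1) → Fin k =>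
        sampleMaj ρ (fun j => x (.inl i, j)) ≠ y (.inl i)).card : ℝ) ≤
        Fintype.card (Fin (2 * m + 1) → Fin k) * (1 / 2 - 3 * (R / k)) := by
      intro i
      obtain ⟨b1, b2⟩ := card_eq_of_gapMaj (hy (.inl i))
      rw [← hs] at b1 b2
      set N : ℝ := ((Finset.univ.filter fun j => x (.inl i, j) = y (.inl i)).card : ℝ)
      have p1 : 4 * (s / k) ≤ 2 * (N / k) - 1 := by
        have h1 : ((k : ℝ) / 2 + 2 * s) / k ≤ N / k := by gcongr
        have h2 : ((k : ℝ) / 2 + 2 * s) / k = 1 / 2 + 2 * (s / k) := by field_simp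
        linarith
      -- The bias is `4 * s / k` up to rounding of the weight; this upper bound keeps it within the
      -- small-bias range of the majority estimate.
      have p2 : 2 * (N / k) - 1 ≤ 5 * (s / k) := by
        rw [← mul_div_assoc, ← mul_div_assoc, sub_le_iff_le_add, div_add_one (by linarith)]
        gcongr
        linarith
      have hsk : s / k = 1 / s := by rw [← hs2]; field_simp
      have p0 : 0 ≤ s / k := by positivity
      have hc := card_sampleMaj_ne_le (m := m) hk (fun j => x (.inl i, j)) (y (.inl i)) rfl
        (by linarith) hm0 (by
          calc (m : ℝ) * (2 * (N / k) - 1) ^ 2 ≤ 37 * L * (5 * (s / k)) ^ 2 := by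
                gcongr; linarith
            _ = 925 * L * s ^ 2 / (k * k) := by ring
            _ = 925 * L / k := by rw [hs2]; field_simp
            _ ≤ 1 / 2 := by rw [div_le_iff₀ (by linarith)]; linarith)
      refine hc.trans ?_
      simp only [Fintype.card_pi, Fintype.card_fin, Finset.prod_const, Finset.card_univ,
        Nat.cast_pow]
      refine mul_le_mul_of_nonneg_left (sub_le_sub_left ?_ _) (by positivity)
      have hsm : 6 * R ≤ s * √(m : ℝ) := by
        rw [hs, ← Real.sqrt_mul (by positivity)]
        refine Real.le_sqrt_of_sq_le ?_
        rw [mul_pow, hR2]; nlinarith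
      calc 3 * (R / k) = 6 * R / k / 2 := by ring
        _ ≤ s * √(m : ℝ) / k / 2 := by gcongr
        _ = 4 * (s / k) * (√(m : ℝ) / 8) := by ring
        _ ≤ _ := by gcongr
    -- At most `k/2 - 3 * R` wrong bits are expected and `k/2 - 2 * R` are tolerated. With `lam = R
    -- / k` the exponent is at most `-L / 2 ≤ -2`.
    have hfar := card_many_failures_le (k := k) (P := Fin (2 * m + 1) → Fin k)
      (fun i ρ => sampleMaj ρ (fun j => x (.inl i, j)) ≠ y (.inl i))
      (μ := 1 / 2 - 3 * (R / k)) (lam := R / k) (T := k / 2 - 2 * R) (by positivity)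
      ((div_le_one (by linarith)).2 hRk) hμ
    have hexp : Real.exp (k * ((1 / 2 - 3 * (R / k)) * (R / k + (R / k) ^ 2)) -
        R / k * (k / 2 - 2 * R)) ≤ 1 / 3 := by
      have e1 : k * ((1 / 2 - 3 * (R / k)) * (R / k + (R / k) ^ 2)) -
          R / k * (k / 2 - 2 * R) = -(R ^ 2 / k / 2) - 3 * (R / k) ^ 2 * R := by
        field_simp; ring
      have e2 : R ^ 2 / k / 2 = L / 2 := by rw [hR2]; field_simp
      rw [e1, e2]
      have h3 : 0 ≤ 3 * (R / k) ^ 2 * R := by positivity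
      calc Real.exp (-(L / 2) - 3 * (R / k) ^ 2 * R) ≤ Real.exp (-(2 : ℝ)) :=
            Real.exp_le_exp.2 (by linarith)
        _ = (Real.exp 2)⁻¹ := Real.exp_neg _
        _ ≤ 1 / 3 := by
            rw [one_div]
            exact inv_anti₀ (by norm_num) (by linarith [Real.add_one_le_exp (2 : ℝ)])
    have hsub : (Finset.univ.filter fun r => (guessTree k (2 * m + 1) r).eval x ≠ v) ⊆
        Finset.univ.filter fun r : Fin k → Fin (2 * m + 1) → Fin k => (k : ℝ) / 2 - 2 * R <
          ((Finset.univ.filter fun i =>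
            sampleMaj (r i) (fun j => x (.inl i, j)) ≠ y (.inl i)).card : ℝ) := by
      intro r hr
      rw [Finset.mem_filter] at hr ⊢
      refine ⟨Finset.mem_univ _, ?_⟩
      by_contra! hle
      refine hr.2 ?_
      -- By the promise every block lies in the domain of `gapMaj`, including the one guessed, so
      -- the default is never used. Near the index all letters are `0` or `1`, so the low bit is the
      -- answer.
      rw [eval_guessTree, hy, Option.getD_some]
      refine approxIndex_eq_some hv _ ?_
      unfold CloseIndex hammingDist
      rw [← hLdef, ← hR]
      convert hle
    have hcard : (Fintype.card (Fin k → Fin (2 * m + 1) → Fin k) : ℝ) =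
        (Fintype.card (Fin (2 * m + 1) → Fin k) : ℝ) ^ k := by
      simp [Fintype.card_pi]
    calc _ ≤ (((Finset.univ.filter fun r : Fin k → Fin (2 * m + 1) → Fin k =>
          (k : ℝ) / 2 - 2 * R < ((Finset.univ.filter fun i =>
            sampleMaj (r i) (fun j => x (.inl i, j)) ≠ y (.inl i)).card : ℝ)).card : ℕ) : ℝ) :=
          Nat.cast_le.2 (Finset.card_le_card hsub)
      _ ≤ _ := hfar
      _ ≤ (Fintype.card (Fin (2 * m + 1) → Fin k) : ℝ) ^ k * (1 / 3) := by gcongr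
      _ = _ := by rw [hcard]; ring
  calc (randQuery ((approxIndex k).comp (gapMaj k)) : ℝ) ≤ ((k * (2 * m + 1) + k : ℕ) : ℝ) :=
        Nat.cast_le.2 hbound
    _ = 2 * k * (m + 1) := by push_cast; ring
    _ ≤ 2 * k * (38 * L) := by gcongr; linarith
    _ = _ := by ring

/-! ### Asymptotic conclusions -/

theorem tendsto_randQuery_approxIndex :
    Tendsto (fun k : ℕ => (randQuery (approxIndex k) : ℝ)) atTop atTop := by
  have h : Tendsto (fun k : ℕ => √(Real.logb 2 (k : ℝ))) atTop atTop :=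
    Real.tendsto_sqrt_atTop.comp tendsto_logb_two_nat
  refine tendsto_atTop_mono' _ ?_ h
  filter_upwards [eventually_lt_randQuery_approxIndex, eventually_ge_atTop 1,
    tendsto_logb_two_nat.eventually_ge_atTop 0] with k hk h1 h0
  refine (Real.sqrt_le_sqrt ?_).trans hk.le
  have : (1 : ℝ) ≤ k := by exact_mod_cast h1
  nlinarith

theorem tendsto_randQuery_gapMaj :
    Tendsto (fun k : ℕ => (randQuery (gapMaj k) : ℝ)) atTop atTop :=
  tendsto_atTop_mono' _ (eventually_lt_randQuery_gapMaj.mono fun _ h => h.le)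
    (tendsto_natCast_atTop_atTop.atTop_div_const (by norm_num))

theorem isBigO_randQuery_comp :
    (fun k : ℕ => (randQuery ((approxIndex k).comp (gapMaj k)) : ℝ)) =O[atTop]
      (fun k : ℕ => (randQuery (approxIndex k) : ℝ) ^ (2 / 3 : ℝ) *
        (randQuery (gapMaj k) : ℝ) ^ (2 / 3 : ℝ) *
        Real.logb 2 (randQuery (approxIndex k) : ℝ) ^ (2 / 3 : ℝ)) := by
  refine IsBigO.of_bound (76 * (4000 : ℝ) ^ (2 / 3 : ℝ)) ?_
  filter_upwards [eventually_lt_randQuery_approxIndex, eventually_lt_randQuery_gapMaj,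
    eventually_randQuery_comp_le, eventually_ge_atTop 1,
    tendsto_logb_two_nat.eventually_ge_atTop 1] with k hf hg hfg hk hL
  set L := Real.logb 2 (k : ℝ) with hLdef
  set A : ℝ := (randQuery (approxIndex k) : ℝ)
  set B : ℝ := (randQuery (gapMaj k) : ℝ)
  have hk' : (1 : ℝ) ≤ k := by exact_mod_cast hk
  set R := √(k * L) with hR
  have hR0 : 0 < R := Real.sqrt_pos.2 (by positivity)
  have hR2 : R ^ 2 = k * L := Real.sq_sqrt (by positivity)
  have hA : 0 < A := hR0.trans hf
  have hB : 0 < B := (by positivity : (0 : ℝ) < k / 2000).trans hg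
  have hlog : L / 2 ≤ Real.logb 2 A := by
    have h1 : √(k : ℝ) ≤ A := (Real.sqrt_le_sqrt (by nlinarith)).trans hf.le
    have h2 : Real.logb 2 (√(k : ℝ)) = L / 2 := by
      rw [Real.logb, Real.log_sqrt (by linarith), hLdef, Real.logb]; ring
    rw [← h2]
    exact Real.logb_le_logb_of_le one_lt_two (Real.sqrt_pos.2 (by linarith)) h1
  have hl0 : 0 ≤ Real.logb 2 A := by linarith
  -- The three factors are at least `R`, `k / 2000` and `L / 2`, while `k * L = R ^ 2`; raising to
  -- the power `2/3` recovers `k * L`.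
  have hX : R ^ 3 ≤ 4000 * (A * B * Real.logb 2 A) := by
    calc R ^ 3 = 4000 * (R * (k / 2000) * (L / 2)) := by
          rw [pow_succ, hR2]; ring
      _ ≤ _ := by gcongr
  have hR23 : (R ^ 3) ^ (2 / 3 : ℝ) = k * L := by
    rw [← hR2, ← Real.rpow_natCast, ← Real.rpow_mul hR0.le, ← Real.rpow_natCast]
    norm_num
  rw [← Real.mul_rpow hA.le hB.le, ← Real.mul_rpow (by positivity) hl0,
    Real.norm_of_nonneg (Nat.cast_nonneg _), Real.norm_of_nonneg (by positivity), mul_assoc,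
    ← Real.mul_rpow (by norm_num) (by positivity)]
  refine hfg.trans ?_
  rw [← hR23]
  gcongr

theorem not_randomizedCompositionConjecture : ¬ RandomizedCompositionConjecture := by
  rintro ⟨c, hc, h⟩
  obtain ⟨k, hf, hg, hfg, hk, hL, hkL⟩ := (eventually_lt_randQuery_approxIndex.and
    (eventually_lt_randQuery_gapMaj.and (eventually_randQuery_comp_le.and
    ((eventually_ge_atTop 1).and ((tendsto_logb_two_nat.eventually_ge_atTop 1).and
    (eventually_mul_logb_two_le ((76 * 2000 / c) ^ 2))))))).exists
  set L := Real.logb 2 (k : ℝ)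
  have hk' : (1 : ℝ) ≤ k := by exact_mod_cast hk
  set R := √(k * L) with hR
  have hR0 : 0 < R := Real.sqrt_pos.2 (by positivity)
  have hR2 : R ^ 2 = k * L := Real.sq_sqrt (by positivity)
  have h1 : c * (R * (k / 2000)) < 76 * R ^ 2 := by
    rw [hR2]
    refine lt_of_lt_of_le ?_ ((h _ _ (approxIndex k) (gapMaj k)).trans hfg)
    gcongr
  -- The conjecture would bound `k` by a constant times `R = √(k * L)`, against `L = o(k)`.
  have h2 : (k : ℝ) < 76 * 2000 / c * R := by
    have h3 : c * k * R < 76 * 2000 * R * R := by linarith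
    rw [div_mul_eq_mul_div, lt_div_iff₀ hc, mul_comm]
    exact lt_of_mul_lt_mul_right h3 hR0.le
  have h3 : (k : ℝ) ^ 2 < (76 * 2000 / c * R) ^ 2 := by gcongr
  rw [mul_pow, hR2] at h3
  have h4 : (k : ℝ) * ((76 * 2000 / c) ^ 2 * L) ≤ k * k := by gcongr
  linarith

theorem mainTheorem3 :
    Tendsto (fun k : ℕ => (randQuery (approxIndex k) : ℝ)) atTop atTop ∧
    Tendsto (fun k : ℕ => (randQuery (gapMaj k) : ℝ)) atTop atTop ∧
    (fun k : ℕ => (randQuery ((approxIndex k).comp (gapMaj k)) : ℝ)) =O[atTop]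
      (fun k : ℕ => (randQuery (approxIndex k) : ℝ) ^ (2 / 3 : ℝ) *
        (randQuery (gapMaj k) : ℝ) ^ (2 / 3 : ℝ) *
        Real.logb 2 (randQuery (approxIndex k) : ℝ) ^ (2 / 3 : ℝ)) ∧
    ¬ RandomizedCompositionConjecture :=
  ⟨tendsto_randQuery_approxIndex, tendsto_randQuery_gapMaj, isBigO_randQuery_comp,
    not_randomizedCompositionConjecture⟩
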